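/- Let $N$ be an even positive integer, $1\le L\le N$ an integer with $r:=\lceil N/L\rceil\ge 5$, and $w:=e^{2\pi\mathbf i L/N}$ (so $w=e^{2\pi\mathbf i/r}$ when $L$ divides $N$). Signals $\mathbf z\in\mathbb C^N$ are regarded as $N$-periodic, with DFT $\hat z_k=\sum_{n=0}^{N-1}z_ne^{-2\pi\mathbf i kn/N}$. A signal is analytic if it is the analytic signal $A\mathbf x$ of some $\mathbf x\in\mathbb R^N$, where $\widehat{Ax}_k=\hat x_k$ for $k\in\{0,N/2\}$, $\widehat{Ax}_k=2\hat x_k$ for $1\le k\le N/2-1$, and $\widehat{Ax}_k=0$ for $N/2+1\le k\le N-1$. Put $\hat y_{k,m}:=\sum_{n=0}^{N-1}z_nz_{n+mL}e^{-2\pi\mathbf i kn/N}$; the numbers $|\hat y_{k,m}|^2$ are the $[N,L]$-FROG measurements of $\mathbf z$. A property is said to hold for generic analytic $\mathbf z$ if the analytic signals for which it fails lie in the zero locus of a real polynomial in the real and imaginary parts of the entries of $\hat{\mathbf z}$ which does not vanish identically on the set of analytic signals. For $\theta,\gamma\in\mathbb R$ the $\theta$-rotation of $\mathbf z$ is $e^{\mathbf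 i\theta}\mathbf z$, the $\gamma$-translation of $\mathbf z$ is the signal with DFT $(\hat z_ke^{2\pi\mathbf i k\gamma/N})_{0\le k\le N-1}$, and the reflection of $\mathbf z$ is the signal $(\overline{z_{-n}})_{0\le n\le N-1}$. **Theorem.** For generic analytic $\mathbf z$ the following holds. Suppose that $\hat z_0\ne0$ and $\hat z_1\ne0$, and consider the system, in the unknown $\tilde{\mathbf z}\in\mathbb C^N$ with $\hat{\tilde z}_k=0$ for $N/2<k\le N-1$, $$|\hat y_{k,m}|=\frac1N\Big|\sum_{l=0}^{k}\hat{\tilde z}_l\hat{\tilde z}_{k-l}w^{lm}\Big|\quad(1\le k\le N/2),\qquad |\hat y_{k,m}|=\frac1N\Big|\sum_{l=k-N/2}^{N/2}\hat{\tilde z}_l\hat{\tilde z}_{k-l}w^{lm}\Big|\quad(N/2+1\le k\le N-1),$$ for $m=0,1,\dots,r-1$. 1. The solutions of this system are exactly the signals obtained from $\mathbf z$ by compositions of arbitrary rotations, arbitrary (real) translations and reflection. 2. Let $\theta_0,\dots,\theta_{N/2}\in\mathbb R$ be any phases with $\hat z_k=|\hat z_k|e^{\mathbf i\theta_k}$ for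 $0\le k\le N/2$. The solutions $\tilde{\mathbf z}$ for which the phases of $\hat{\tilde z}_0$ and $\hat{\tilde z}_1$ are both zero are exactly the signal with DFT $$\big(|\hat z_0|,\ |\hat z_1|,\ \mathfrak E(2)|\hat z_2|e^{\mathbf i(\theta_2-2\theta_1)},\ \dots,\ \mathfrak E(N/2)|\hat z_{N/2}|e^{\mathbf i(\theta_{N/2}-(N/2)\theta_1)},\ 0,\dots,0\big)$$ and its reflection, where $\mathfrak E(k)=\operatorname{sgn}(\hat z_0)$ for even $k$ and $\mathfrak E(k)=1$ for odd $k$ (recall that $\hat z_0$ is real). -/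

import Mathlib

noncomputable section

namespace FROG

/-- The `N`-periodic signals; the DFT `ẑ` of `z` is Mathlib's `ZMod.dft`, that is
`ẑ k = ∑ n, z n * exp (-2πi k n / N)`. -/
abbrev Signal (N : ℕ) : Type := ZMod N → ℂ

/-- The analytic signal `Ax` of a real signal `x`: its DFT is `x̂ k` for `k = 0` and for `k = N/2`
(when `N` is even), `2 x̂ k` for `0 < k < N/2`, and `0` for `N/2 < k < N`. -/
def analyticSignal (N : ℕ) [NeZero N] (x : ZMod N → ℝ) : Signal N :=
  ZMod.dft.symm fun k : ZMod N =>
    if k.val = 0 ∨ 2 * k.val = N then ZMod.dft (fun n => (x n : ℂ)) k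
    else if 2 * k.val < N then 2 * ZMod.dft (fun n => (x n : ℂ)) k
    else 0

/-- A signal is analytic if it is the analytic signal of some real signal. -/
def IsAnalytic {N : ℕ} [NeZero N] (z : Signal N) : Prop :=
  ∃ x : ZMod N → ℝ, z = analyticSignal N x

/-- The real and imaginary parts of the DFT entries, as real coordinates of a signal. -/
def coords {N : ℕ} [NeZero N] (z : Signal N) : ZMod N ⊕ ZMod N → ℝ :=
  Sum.elim (fun k => (ZMod.dft z k).re) (fun k => (ZMod.dft z k).im)

/-- `Q` holds for generic analytic signals: the analytic signals for which it fails lie in the zero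
locus of a real polynomial (in the real coordinates of the signal) that does not vanish identically
on the real vector space of analytic signals. -/
def ForGenericAnalytic (N : ℕ) [NeZero N] (Q : Signal N → Prop) : Prop :=
  ∃ P : MvPolynomial (ZMod N ⊕ ZMod N) ℝ,
    (∃ z : Signal N, IsAnalytic z ∧ MvPolynomial.eval (coords z) P ≠ 0) ∧
    ∀ z : Signal N, IsAnalytic z → MvPolynomial.eval (coords z) P ≠ 0 → Q z

/-- `r = ⌈N / L⌉`, the number of delays. -/
def numDelays (N L : ℕ) : ℕ := ⌈(N : ℝ) / (L : ℝ)⌉₊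

/-- `ŷ_{k,m}`, the DFT at `k` of `y_{n,m} = z_n z_{n+mL}`. -/
def yHat {N : ℕ} [NeZero N] (L : ℕ) (z : Signal N) (k m : ℕ) : ℂ :=
  ZMod.dft (fun n : ZMod N => z n * z (n + ((m * L : ℕ) : ZMod N))) (k : ZMod N)

/-- The `[N, L]`-FROG measurement `|ŷ_{k,m}|²` of `z` at `(k, m)`. -/
def frogMeasurement {N : ℕ} [NeZero N] (L : ℕ) (z : Signal N) (k m : ℕ) : ℝ :=
  ‖yHat L z k m‖ ^ 2

/-- The phase factor `w = exp (2πi L / N)` of a unit delay. It is `exp (2πi / r)` when `L ∣ N`,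
see `phaseFactor_eq`. -/
def phaseFactor (N L : ℕ) : ℂ :=
  Complex.exp (2 * Real.pi * Complex.I * ((L : ℂ) / (N : ℂ)))

theorem phaseFactor_eq {N L : ℕ} (hN : 0 < N) (h : L ∣ N) :
    phaseFactor N L = Complex.exp (2 * Real.pi * Complex.I / (numDelays N L : ℂ)) := by
  obtain ⟨r, rfl⟩ := h
  have hL : (L : ℝ) ≠ 0 := by
    have := Nat.pos_of_mul_pos_right hN
    positivity
  have hL' : (L : ℂ) ≠ 0 := by exact_mod_cast hL
  have hr : numDelays (L * r) L = r := by
    have : ((L * r : ℕ) : ℝ) / (L : ℝ) = (r : ℝ) := by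
      push_cast
      field_simp
    rw [numDelays, this, Nat.ceil_natCast]
  have hr0 : (r : ℂ) ≠ 0 := by
    have := Nat.pos_of_mul_pos_left hN
    exact_mod_cast this.ne'
  rw [hr, phaseFactor]
  congr 1
  push_cast
  field_simp

/-- `zt` has DFT supported in `{0, …, N/2}`. -/
def HasHalfSupport {N : ℕ} [NeZero N] (zt : Signal N) : Prop :=
  ∀ k : ZMod N, N / 2 < k.val → ZMod.dft zt k = 0

/-- `zt` solves the relaxed FROG system (without the equations for `k = 0`) whose data are the
`[N, L]`-FROG measurements of `z`. -/
def SolvesRelaxed {N : ℕ} [NeZero N] (L : ℕ) (z zt : Signal N) : Prop :=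
  HasHalfSupport zt ∧
  ∀ m < numDelays N L,
    (∀ k ∈ Finset.Icc 1 (N / 2),
      Real.sqrt (frogMeasurement L z k m) = 1 / (N : ℝ) *
        ‖∑ l ∈ Finset.range (k + 1),
          ZMod.dft zt (l : ZMod N) * ZMod.dft zt ((k - l : ℕ) : ZMod N)
            * phaseFactor N L ^ (l * m)‖) ∧
    (∀ k ∈ Finset.Icc (N / 2 + 1) (N - 1),
      Real.sqrt (frogMeasurement L z k m) = 1 / (N : ℝ) *
        ‖∑ l ∈ Finset.Icc (k - N / 2) (N / 2),
          ZMod.dft zt (l : ZMod N) * ZMod.dft zt ((k - l : ℕ) : ZMod N)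
            * phaseFactor N L ^ (l * m)‖)

/-- The `θ`-rotation `e^{iθ} z`. -/
def rotation {N : ℕ} (θ : ℝ) (z : Signal N) : Signal N :=
  fun n => Complex.exp (θ * Complex.I) * z n

/-- The `γ`-translation, with DFT `ẑ k * exp (2πi k γ / N)` for `0 ≤ k < N`. -/
def translation {N : ℕ} [NeZero N] (γ : ℝ) (z : Signal N) : Signal N :=
  ZMod.dft.symm fun k : ZMod N =>
    ZMod.dft z k * Complex.exp (2 * Real.pi * Complex.I * (k.val : ℂ) * (γ : ℂ) / (N : ℂ))

/-- The reflection, with entries `conj (z (-n))`. -/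
def reflection {N : ℕ} (z : Signal N) : Signal N :=
  fun n => starRingEnd ℂ (z (-n))

/-- `u` arises from `v` by rotations, translations and reflections. Rotations and translations
commute, each family is a one-parameter group, and conjugation by the reflection inverts both, so
every composition has one of these two forms. -/
def SameUpToAmbiguity {N : ℕ} [NeZero N] (u v : Signal N) : Prop :=
  ∃ θ γ : ℝ, u = rotation θ (translation γ v) ∨ u = rotation θ (translation γ (reflection v))

/-- `𝔈(k)`: the sign of `s` for even `k`, and `1` for odd `k`. -/
def signFactor (s : ℝ) (k : ℕ) : ℝ := if Even k then Real.sign s else 1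

/-- The signal with DFT `(|ẑ₀|, |ẑ₁|, 𝔈(2)|ẑ₂|e^{i(θ₂-2θ₁)}, …, 𝔈(N/2)|ẑ_{N/2}|e^{i(θ_{N/2}-(N/2)θ₁)},
0, …, 0)`, where `𝔈` is formed with the real number `ẑ₀`. -/
def normalizedSolution {N : ℕ} [NeZero N] (z : Signal N) (θ : ℕ → ℝ) : Signal N :=
  ZMod.dft.symm fun k : ZMod N =>
    if k.val = 0 then (‖ZMod.dft z 0‖ : ℂ)
    else if k.val = 1 then (‖ZMod.dft z 1‖ : ℂ)
    else if k.val ≤ N / 2 then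
      (signFactor (ZMod.dft z 0).re k.val : ℂ) * (‖ZMod.dft z k‖ : ℂ)
        * Complex.exp (((θ k.val - (k.val : ℝ) * θ 1 : ℝ) : ℂ) * Complex.I)
    else 0

end FROG

end

/-!
Write `N = 2M`, `ψ = πL/N` and `a = ẑ₀, …, ẑ_M, 0, 0, …`. Up to a phase, `N ŷ_{k,m}` is
`∑ l ≤ k, a l * a (k - l) * cos ((k - 2l) m ψ)`, so the system prescribes the moduli of these cosine
sums. They are unchanged when `a` is multiplied by a geometric progression `x y ^ j` in the unit
circle or conjugated, which is the effect of rotations, translations and reflection; after division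
by a geometric progression, `a 0 = a 1 = 1`. Since `r ≥ 5`, `0 < ψ < π/4` and the delays `m < 5` are
available.

Order `2` determines `a 2` up to conjugation. Given `a 2`, order `3` determines `a 3` up to the
reflection across the line of `a 2`, and order `4` excludes the wrong choice for generic `a`. Once
the entries below `k ≥ 4` are known, order `k` at three suitable delays gives a linear system for
`|a k|²`, `re (a k)` and `im (a k)`, whose determinant is generically nonzero. Suitable delays are
lacking only if `cos (kψ) = 0` and `ψ = π/6`; then orders `k` and `k + 1` together determine `a k`
(order `M + 1` if `k = M`).

A generic condition on sequences is one on analytic signals: the DFT of an analytic signal is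
arbitrary below `N/2` except that `ẑ₀` is real, and a power of `|ẑ₀ ẑ₁|²` clears the denominators
created by the normalization.
-/

noncomputable section

namespace FROG

open scoped ComplexConjugate

/-! ### Generic sequences -/

section PolynomialFunctions

variable {X : Type*} {A : StarSubalgebra ℂ (X → ℂ)} {f : X → ℂ}

theorem const_mem (A : StarSubalgebra ℂ (X → ℂ)) (c : ℂ) : (fun _ => c) ∈ A :=
  algebraMap_mem A c

theorem ofReal_re_mem (hf : f ∈ A) : (fun x => ((f x).re : ℂ)) ∈ A := by
  convert mul_mem (const_mem A (1 / 2)) (add_mem hf (star_mem hf)) using 1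
  ext x
  simp [Complex.re_eq_add_conj, div_eq_inv_mul]

theorem ofReal_im_mem (hf : f ∈ A) : (fun x => ((f x).im : ℂ)) ∈ A := by
  simpa using ofReal_re_mem (mul_mem (const_mem A (-Complex.I)) hf)

theorem ofReal_normSq_mem (hf : f ∈ A) : (fun x => (Complex.normSq (f x) : ℂ)) ∈ A := by
  simp only [← Complex.mul_conj]
  exact mul_mem hf (star_mem hf)

end PolynomialFunctions

/-- The polynomial functions in the entries of index less than `M` of a complex sequence and their
conjugates. -/
def seqPoly (M : ℕ) : StarSubalgebra ℂ ((ℕ → ℂ) → ℂ) :=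
  StarAlgebra.adjoin ℂ ((fun j α => α j) '' Set.Iio M)

section SeqPoly

variable {M : ℕ} {f g : (ℕ → ℂ) → ℂ}

theorem entry_mem_seqPoly {j : ℕ} (hj : j < M) : (fun α => α j) ∈ seqPoly M :=
  StarAlgebra.subset_adjoin ℂ _ ⟨j, hj, rfl⟩

theorem seqPoly_mono : Monotone seqPoly := fun _ _ h =>
  StarAlgebra.adjoin_mono (Set.image_mono (Set.Iio_subset_Iio h))

theorem eq_of_mem_seqPoly (hf : f ∈ seqPoly M) {α β : ℕ → ℂ} (h : ∀ j < M, α j = β j) :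
    f α = f β := by
  rw [seqPoly] at hf
  induction hf using StarAlgebra.adjoin_induction with
  | mem f hf =>
    obtain ⟨j, hj, rfl⟩ := hf
    exact h j hj
  | algebraMap c => rfl
  | add f g _ _ hf hg => simp only [Pi.add_apply, hf, hg]
  | mul f g _ _ hf hg => simp only [Pi.mul_apply, hf, hg]
  | star f _ hf => simp only [Pi.star_apply, hf]

theorem exists_polynomial_line (hf : f ∈ seqPoly M) (α β : ℕ → ℂ) :
    ∃ p : Polynomial ℂ, ∀ t : ℝ, f (fun j => α j + t * (β j - α j)) = p.eval (t : ℂ) := by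
  rw [seqPoly] at hf
  induction hf using StarAlgebra.adjoin_induction with
  | mem f hf =>
    obtain ⟨j, -, rfl⟩ := hf
    exact ⟨Polynomial.C (α j) + Polynomial.X * Polynomial.C (β j - α j), fun t => by simp⟩
  | algebraMap c => exact ⟨Polynomial.C c, fun t => by simp⟩
  | add f g _ _ hf hg =>
    obtain ⟨p, hp⟩ := hf
    obtain ⟨q, hq⟩ := hg
    exact ⟨p + q, fun t => by simp [hp, hq]⟩
  | mul f g _ _ hf hg =>
    obtain ⟨p, hp⟩ := hf
    obtain ⟨q, hq⟩ := hg
    exact ⟨p * q, fun t => by simp [hp, hq]⟩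
  | star f _ hf =>
    obtain ⟨p, hp⟩ := hf
    refine ⟨p.map (starRingEnd ℂ), fun t => ?_⟩
    rw [Pi.star_apply, hp, Complex.star_def, ← Polynomial.eval_map_apply, Complex.conj_ofReal]

theorem exists_ofReal_eval_ne_zero {p : Polynomial ℂ} (hp : p ≠ 0) :
    ∃ t : ℝ, p.eval (t : ℂ) ≠ 0 := by
  by_contra! h
  refine hp (Polynomial.eq_zero_of_infinite_isRoot _
    ((Set.infinite_range_of_injective Complex.ofReal_injective).mono ?_))
  rintro _ ⟨t, rfl⟩
  exact h t

theorem exists_line_mul_ne_zero (hf : f ∈ seqPoly M) (hg : g ∈ seqPoly M) {α β : ℕ → ℂ}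
    (hα : f α ≠ 0) (hβ : g β ≠ 0) :
    ∃ t : ℝ, (f * g) (fun j => α j + t * (β j - α j)) ≠ 0 := by
  obtain ⟨p, hp⟩ := exists_polynomial_line hf α β
  obtain ⟨q, hq⟩ := exists_polynomial_line hg α β
  have hp0 : p ≠ 0 := fun h => hα (by simpa [h] using hp 0)
  have hq0 : q ≠ 0 := fun h => hβ (by simpa [h] using hq 1)
  obtain ⟨t, ht⟩ := exists_ofReal_eval_ne_zero (mul_ne_zero hp0 hq0)
  exact ⟨t, by simpa [hp, hq] using ht⟩

end SeqPoly

/-- `S` holds for generic sequences that start with `1, 1`: off the zero locus of a polynomial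
function of the entries of index less than `M` that does not vanish identically. -/
def GenericSeq (M : ℕ) (S : (ℕ → ℂ) → Prop) : Prop :=
  ∃ f ∈ seqPoly M, (∃ α, α 0 = 1 ∧ α 1 = 1 ∧ f α ≠ 0) ∧
    ∀ α, α 0 = 1 → α 1 = 1 → f α ≠ 0 → S α

namespace GenericSeq

variable {M : ℕ} {S T : (ℕ → ℂ) → Prop}

theorem of_ofReal {F : (ℕ → ℂ) → ℝ} (hF : (fun α => (F α : ℂ)) ∈ seqPoly M)
    (h : ∃ α, α 0 = 1 ∧ α 1 = 1 ∧ F α ≠ 0) : GenericSeq M fun α => F α ≠ 0 := by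
  simp only [← Complex.ofReal_ne_zero] at h ⊢
  exact ⟨_, hF, h, fun _ _ _ h => h⟩

theorem exists_seq (hS : GenericSeq M S) : ∃ α, α 0 = 1 ∧ α 1 = 1 ∧ S α := by
  obtain ⟨f, -, ⟨α, h0, h1, hα⟩, hfS⟩ := hS
  exact ⟨α, h0, h1, hfS α h0 h1 hα⟩

theorem mono (hS : GenericSeq M S) (h : ∀ α, α 0 = 1 → α 1 = 1 → S α → T α) :
    GenericSeq M T := by
  obtain ⟨f, hf, hw, hfS⟩ := hS
  exact ⟨f, hf, hw, fun α h0 h1 hα => h α h0 h1 (hfS α h0 h1 hα)⟩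

theorem of_forall (h : ∀ α, α 0 = 1 → α 1 = 1 → S α) : GenericSeq M S :=
  ⟨fun _ => 1, const_mem _ 1, ⟨fun _ => 1, by simp⟩, fun α h0 h1 _ => h α h0 h1⟩

theorem and (hS : GenericSeq M S) (hT : GenericSeq M T) : GenericSeq M fun α => S α ∧ T α := by
  obtain ⟨f, hf, ⟨α, hα0, hα1, hα⟩, hfS⟩ := hS
  obtain ⟨g, hg, ⟨β, hβ0, hβ1, hβ⟩, hgT⟩ := hT
  obtain ⟨t, ht⟩ := exists_line_mul_ne_zero hf hg hα hβ
  exact ⟨f * g, mul_mem hf hg, ⟨_, by simp [hα0, hβ0], by simp [hα1, hβ1], ht⟩,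
    fun γ h0 h1 h => ⟨hfS γ h0 h1 (left_ne_zero_of_mul h), hgT γ h0 h1 (right_ne_zero_of_mul h)⟩⟩

theorem ball {ι : Type*} (s : Finset ι) {F : ι → (ℕ → ℂ) → Prop}
    (h : ∀ i ∈ s, GenericSeq M (F i)) : GenericSeq M fun α => ∀ i ∈ s, F i α := by
  classical
  induction s using Finset.induction_on with
  | empty => exact of_forall (by simp)
  | insert i s _ ih =>
    simp only [Finset.forall_mem_insert] at h ⊢
    exact h.1.and (ih h.2)

end GenericSeq

/-! ### Cosine sums -/

/-- The part of the cosine sum of order `k` of the sequence `a` that omits the first `i` and the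
last `i` terms. -/
def cosSum (a : ℕ → ℂ) (k i : ℕ) (t : ℝ) : ℂ :=
  ∑ l ∈ Finset.Ico i (k + 1 - i), a l * a (k - l) * (Real.cos ((2 * l - k) * t) : ℂ)

theorem norm_sum_exp_eq_norm_cosSum (a : ℕ → ℂ) (k : ℕ) (t : ℝ) :
    ‖∑ l ∈ Finset.range (k + 1), a l * a (k - l) * Complex.exp (2 * t * Complex.I) ^ l‖
      = ‖cosSum a k 0 t‖ := by
  have h_center : ∑ l ∈ Finset.range (k + 1), a l * a (k - l) * Complex.exp (2 * t * Complex.I) ^ l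
      = Complex.exp ((k * t : ℝ) * Complex.I) * ∑ l ∈ Finset.range (k + 1),
        a l * a (k - l) * Complex.exp (((2 * l - k) * t : ℝ) * Complex.I) := by
    rw [Finset.mul_sum]
    refine Finset.sum_congr rfl fun l _ => ?_
    rw [← Complex.exp_nat_mul, mul_left_comm (Complex.exp _), ← Complex.exp_add]
    congr 2
    push_cast
    ring
  have h_reflect : ∑ l ∈ Finset.range (k + 1),
        a l * a (k - l) * Complex.exp (((2 * l - k) * t : ℝ) * Complex.I)
      = ∑ l ∈ Finset.range (k + 1),
        a l * a (k - l) * Complex.exp (-((2 * l - k) * t : ℝ) * Complex.I) := by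
    rw [← Finset.sum_range_reflect]
    refine Finset.sum_congr rfl fun l hl => ?_
    have hl' : l ≤ k := by simpa [Nat.lt_succ_iff] using hl
    rw [Nat.add_sub_cancel, Nat.sub_sub_self hl', mul_comm (a (k - l))]
    congr 2
    push_cast [Nat.cast_sub hl']
    ring
  have h_average : ∑ l ∈ Finset.range (k + 1),
        a l * a (k - l) * Complex.exp (((2 * l - k) * t : ℝ) * Complex.I) = cosSum a k 0 t := by
    have eq_half_add (z w : ℂ) (h : z = w) : z = (z + w) / 2 := by
      rw [← h, add_self_div_two]
    rw [eq_half_add _ _ h_reflect, ← Finset.sum_add_distrib, cosSum, Finset.sum_div, Nat.sub_zero,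
      Finset.range_eq_Ico]
    refine Finset.sum_congr rfl fun l _ => ?_
    rw [Complex.ofReal_cos, Complex.cos]
    ring
  rw [h_center, norm_mul, Complex.norm_exp_ofReal_mul_I, one_mul, h_average]

theorem cosSum_eq_add {a : ℕ → ℂ} {k i : ℕ} (h : 2 * i < k) (t : ℝ) :
    cosSum a k i t
      = 2 * (a i * a (k - i)) * (Real.cos ((k - 2 * i) * t) : ℂ) + cosSum a k (i + 1) t := by
  have e1 : k + 1 - i = (k - i) + 1 := by omega
  have e2 : k + 1 - (i + 1) = k - i := by omega
  have e3 : k - (k - i) = i := by omega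
  rw [cosSum, e1, Finset.sum_Ico_succ_top (by omega), Finset.sum_eq_sum_Ico_succ_bot (by omega),
    cosSum, e2, e3]
  have e4 : ((2 * i - k : ℝ) * t) = -((k - 2 * i) * t) := by ring
  have e5 : ((2 * ((k - i : ℕ) : ℝ) - k : ℝ) * t) = (k - 2 * i) * t := by
    rw [Nat.cast_sub (by omega)]
    ring
  rw [e4, e5, Real.cos_neg]
  ring

theorem cosSum_two_mul (a : ℕ → ℂ) (i : ℕ) (t : ℝ) : cosSum a (2 * i) i t = a i ^ 2 := by
  have e1 : 2 * i + 1 - i = i + 1 := by omega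
  have e2 : 2 * i - i = i := by omega
  rw [cosSum, e1, Nat.Ico_succ_singleton, Finset.sum_singleton, e2]
  simp
  ring

theorem cosSum_of_lt {a : ℕ → ℂ} {k i : ℕ} (h : k < 2 * i) (t : ℝ) : cosSum a k i t = 0 := by
  rw [cosSum, Finset.Ico_eq_empty (by omega), Finset.sum_empty]

theorem cosSum_congr {a b : ℕ → ℂ} {k i : ℕ} (h : ∀ j, i ≤ j → j ≤ k - i → a j = b j) (t : ℝ) :
    cosSum a k i t = cosSum b k i t := by
  refine Finset.sum_congr rfl fun l hl => ?_
  rw [Finset.mem_Ico] at hl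
  rw [h l (by omega) (by omega), h (k - l) (by omega) (by omega)]

theorem cosSum_conj (a : ℕ → ℂ) (k i : ℕ) (t : ℝ) :
    cosSum (fun j => conj (a j)) k i t = conj (cosSum a k i t) := by
  simp [cosSum, map_sum, -Complex.ofReal_cos]

theorem cosSum_scale (a : ℕ → ℂ) (x y : ℂ) (k i : ℕ) (t : ℝ) :
    cosSum (fun j => x * y ^ j * a j) k i t = x ^ 2 * y ^ k * cosSum a k i t := by
  rw [cosSum, cosSum, Finset.mul_sum]
  refine Finset.sum_congr rfl fun l hl => ?_
  rw [Finset.mem_Ico] at hl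
  have e : k = l + (k - l) := by omega
  have : y ^ k = y ^ l * y ^ (k - l) := by rw [← pow_add, ← e]
  rw [this]
  ring

theorem cosSum_mem_seqPoly {M k i : ℕ} (h : k < M + i) (t : ℝ) :
    (fun α => cosSum α k i t) ∈ seqPoly M := by
  simp only [cosSum, ← Finset.sum_fn]
  refine sum_mem fun l hl => ?_
  rw [Finset.mem_Ico] at hl
  exact mul_mem (mul_mem (entry_mem_seqPoly (by omega)) (entry_mem_seqPoly (by omega)))
    (const_mem _ _)

theorem exists_seq_cosSum_eq {k : ℕ} (hk : 3 ≤ k) (c : ℕ → ℂ) :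
    ∃ α : ℕ → ℂ, α 0 = 1 ∧ α 1 = 1 ∧ ∀ (i : ℕ) (t : ℝ), cosSum α k i t =
      ∑ l ∈ Finset.Ico i (k / 2 + 1), 2 * c l * (Real.cos ((k - 2 * l) * t) : ℂ) := by
  obtain ⟨x, hx⟩ := IsAlgClosed.exists_pow_nat_eq (2 * c (k / 2)) two_pos
  let α : ℕ → ℂ := fun j => if 2 * j < k then 1 else if 2 * j = k then x else c (k - j)
  have α_low {j : ℕ} (hj : 2 * j < k) : α j = 1 := by simp [α, hj]
  refine ⟨α, α_low (by omega), α_low (by omega), fun i t => ?_⟩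
  generalize hd : k + 1 - 2 * i = d
  induction d using Nat.strong_induction_on generalizing i with
  | _ d ih =>
    rcases lt_trichotomy (2 * i) k with h | rfl | h
    · have α_high : α (k - i) = c i := by
        simp only [α, if_neg (show ¬ 2 * (k - i) < k by omega),
          if_neg (show 2 * (k - i) ≠ k by omega), Nat.sub_sub_self (show i ≤ k by omega)]
      rw [cosSum_eq_add h, Finset.sum_eq_sum_Ico_succ_bot (by omega),
        ih _ (by omega) (i + 1) rfl, α_low h, α_high, one_mul]
    · simpa [cosSum_two_mul, α, show 2 * i / 2 = i by omega] using hx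
    · rw [cosSum_of_lt h, Finset.Ico_eq_empty (by omega), Finset.sum_empty]

theorem exists_seq_cosSum_eq_two_frequencies {k i l l' : ℕ} (hk : 3 ≤ k)
    (hl : l ∈ Finset.Ico i (k / 2 + 1)) (hl' : l' ∈ Finset.Ico i (k / 2 + 1)) :
    ∃ α : ℕ → ℂ, α 0 = 1 ∧ α 1 = 1 ∧ ∀ t : ℝ, cosSum α k i t =
      2 * (Real.cos ((k - 2 * l') * t) : ℂ) +
        2 * Complex.I * (Real.cos ((k - 2 * l) * t) : ℂ) := by
  obtain ⟨α, h0, h1, hα⟩ := exists_seq_cosSum_eq hk fun j =>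
    (if j = l' then 1 else 0) + if j = l then Complex.I else 0
  refine ⟨α, h0, h1, fun t => ?_⟩
  simp only [hα, mul_add, add_mul, mul_ite, ite_mul, mul_one, mul_zero, zero_mul,
    Finset.sum_add_distrib, Finset.sum_ite_eq', hl, hl', if_true]

theorem norm_eq_norm_iff (z w : ℂ) :
    ‖z‖ = ‖w‖ ↔ z.re ^ 2 + z.im ^ 2 = w.re ^ 2 + w.im ^ 2 := by
  rw [← sq_eq_sq₀ (norm_nonneg _) (norm_nonneg _), Complex.sq_norm, Complex.sq_norm,
    Complex.normSq_apply, Complex.normSq_apply, sq, sq, sq, sq]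

theorem eq_or_eq_conj {z w : ℂ} (h : ‖z‖ = ‖w‖) (hre : z.re = w.re) : z = w ∨ z = conj w := by
  have h_im : z.im ^ 2 = w.im ^ 2 := by
    rw [norm_eq_norm_iff, hre] at h
    exact add_left_cancel h
  rcases sq_eq_sq_iff_eq_or_eq_neg.1 h_im with h_im | h_im
  · exact .inl (Complex.ext hre h_im)
  · exact .inr (Complex.ext (by simpa using hre) (by simpa using h_im))

theorem quadratic_eq_zero {d : Fin 3 → ℝ} (hd : Function.Injective d) {X Y Z : ℝ}
    (h : ∀ i, X * d i ^ 2 + Y * d i + Z = 0) : X = 0 ∧ Y = 0 ∧ Z = 0 := by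
  have hv : ![Z, Y, X] = 0 := Matrix.eq_zero_of_forall_index_sum_pow_mul_eq_zero hd fun i => by
    rw [Fin.sum_univ_three, ← h i]
    simp
    ring
  exact ⟨congrFun hv 2, congrFun hv 1, congrFun hv 0⟩

theorem exists_quadratic_interpolation {d : Fin 3 → ℝ} (hd : Function.Injective d)
    (g : Fin 3 → ℝ) : ∃ a b c : ℝ, ∀ i, g i = a * d i ^ 2 + b * d i + c := by
  have hdet : IsUnit (Matrix.vandermonde d).det := (Matrix.det_vandermonde_ne_zero_iff.2 hd).isUnit
  let v := (Matrix.vandermonde d)⁻¹.mulVec g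
  have hv : (Matrix.vandermonde d).mulVec v = g := by
    rw [Matrix.mulVec_mulVec, Matrix.mul_nonsing_inv _ hdet, Matrix.one_mulVec]
  refine ⟨v 2, v 1, v 0, fun i => ?_⟩
  rw [← congrFun hv i, Matrix.mulVec, dotProduct, Fin.sum_univ_three]
  simp [Matrix.vandermonde]
  ring

theorem norm_affine_eq {a b a' b' : ℂ} {d : Fin 3 → ℝ} (hd : Function.Injective d)
    (h : ∀ i, ‖a * d i + b‖ = ‖a' * d i + b'‖) :
    ‖a‖ = ‖a'‖ ∧ (a * conj b).re = (a' * conj b').re ∧ ‖b‖ = ‖b'‖ := by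
  have key : ∀ i, (a.re ^ 2 + a.im ^ 2 - (a'.re ^ 2 + a'.im ^ 2)) * d i ^ 2
      + 2 * ((a * conj b).re - (a' * conj b').re) * d i
      + (b.re ^ 2 + b.im ^ 2 - (b'.re ^ 2 + b'.im ^ 2)) = 0 := by
    intro i
    have := (norm_eq_norm_iff _ _).1 (h i)
    simp at this ⊢
    linear_combination this
  obtain ⟨h1, h2, h3⟩ := quadratic_eq_zero hd key
  simp only [norm_eq_norm_iff]
  exact ⟨by linarith, by linarith, by linarith⟩

theorem mul_normSq_sub_add_re_eq_zero {a b R : ℂ} {u : ℝ} (hu : u ≠ 0)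
    (h : ‖u * b + R‖ = ‖u * a + R‖) :
    u * (Complex.normSq b - Complex.normSq a) + 2 * ((b - a) * conj R).re = 0 := by
  rw [norm_eq_norm_iff] at h
  refine mul_left_cancel₀ hu ?_
  simp [Complex.normSq_apply, -mul_eq_zero] at h ⊢
  linear_combination h

theorem exists_det_cons_ne_zero {K : Type*} [Field K] {e : Matrix (Fin 3) (Fin 3) K}
    (he : e.det ≠ 0) {v : Fin 3 → K} (hv : v ≠ 0) : ∃ p q, (Matrix.of ![v, e p, e q]).det ≠ 0 := by
  by_contra! h
  have cramer (i : Fin 3) : e.det * v i = (Matrix.of ![v, e 1, e 2]).det * e 0 i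
      + (Matrix.of ![v, e 2, e 0]).det * e 1 i + (Matrix.of ![v, e 0, e 1]).det * e 2 i := by
    fin_cases i <;> simp [Matrix.det_fin_three] <;> ring
  exact hv (funext fun i => (mul_eq_zero.1 (by simp [cramer, h])).resolve_left he)

theorem eq_zero_of_det_re_im_ne_zero {C : Fin 3 → ℝ} {R : Fin 3 → ℂ}
    (hD : (Matrix.of ![C, fun i => (R i).re, fun i => (R i).im]).det ≠ 0) {X : ℝ} {δ : ℂ}
    (h : ∀ i, C i * X + (δ * conj (R i)).re = 0) : δ = 0 := by
  have hv := Matrix.eq_zero_of_vecMul_eq_zero (v := ![X, δ.re, δ.im]) hD <| funext fun i => by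
    rw [Pi.zero_apply, ← h i, Matrix.vecMul_eq_sum, Fin.sum_univ_three]
    simp
    ring
  exact Complex.ext (congrFun hv 1) (congrFun hv 2)

theorem cos_three_mul_eq (x : ℝ) :
    Real.cos (3 * x) = Real.cos x * (2 * Real.cos (2 * x) - 1) := by
  rw [Real.cos_three_mul, Real.cos_two_mul]
  ring

theorem cos_four_mul (x : ℝ) : Real.cos (4 * x) = 2 * Real.cos (2 * x) ^ 2 - 1 := by
  rw [← Real.cos_two_mul]
  ring_nf

theorem cos_five_mul (x : ℝ) :
    Real.cos (5 * x) = Real.cos x * (4 * Real.cos (2 * x) ^ 2 - 2 * Real.cos (2 * x) - 1) := by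
  have h_add := Real.cos_add (3 * x) (2 * x)
  have h_sub := Real.cos_sub (3 * x) (2 * x)
  rw [show 3 * x + 2 * x = 5 * x by ring] at h_add
  rw [show 3 * x - 2 * x = x by ring] at h_sub
  linear_combination h_add + h_sub + 2 * Real.cos (2 * x) * cos_three_mul_eq x

theorem cos_odd_mul_eq_zero {x : ℝ} (h : Real.cos x = 0) (j : ℕ) :
    Real.cos ((2 * j + 1) * x) = 0 := by
  rw [Real.cos_eq_zero_iff] at h ⊢
  obtain ⟨n, rfl⟩ := h
  refine ⟨2 * j * n + j + n, ?_⟩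
  push_cast
  ring

section Determinants

variable {t : Fin 3 → ℝ} (ht : Function.Injective fun i => Real.cos (2 * t i))

include ht

theorem det_cos_even_mul_ne_zero :
    (Matrix.of fun q i : Fin 3 => Real.cos ((2 * (q : ℕ) : ℝ) * t i)).det ≠ 0 := by
  rw [Ne, ← Matrix.exists_vecMul_eq_zero_iff]
  rintro ⟨v, hv0, hv⟩
  refine hv0 ?_
  have h : ∀ i, 2 * v 2 * Real.cos (2 * t i) ^ 2 + v 1 * Real.cos (2 * t i) + (v 0 - v 2) = 0 := by
    intro i
    have hi := congrFun hv i
    simp only [Matrix.vecMul_eq_sum, Fin.sum_univ_three, Pi.add_apply, Pi.smul_apply, smul_eq_mul,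
      Matrix.of_apply, Fin.val_zero, Fin.val_one, Fin.val_two, Pi.zero_apply] at hi
    norm_num [cos_four_mul] at hi
    linear_combination hi
  obtain ⟨h2, h1, h0⟩ := quadratic_eq_zero ht h
  ext q
  fin_cases q
  · exact (sub_eq_zero.1 h0).trans (by simpa using h2)
  · exact h1
  · simpa using h2

theorem det_cos_odd_mul_ne_zero (h0 : ∀ i, Real.cos (t i) ≠ 0) :
    (Matrix.of fun q i : Fin 3 => Real.cos ((2 * (q : ℕ) + 1 : ℝ) * t i)).det ≠ 0 := by
  rw [Ne, ← Matrix.exists_vecMul_eq_zero_iff]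
  rintro ⟨v, hv0, hv⟩
  refine hv0 ?_
  have h : ∀ i, 4 * v 2 * Real.cos (2 * t i) ^ 2 + 2 * (v 1 - v 2) * Real.cos (2 * t i)
      + (v 0 - v 1 - v 2) = 0 := by
    intro i
    have hi := congrFun hv i
    simp only [Matrix.vecMul_eq_sum, Fin.sum_univ_three, Pi.add_apply, Pi.smul_apply, smul_eq_mul,
      Matrix.of_apply, Fin.val_zero, Fin.val_one, Fin.val_two, Pi.zero_apply] at hi
    norm_num [cos_three_mul_eq, cos_five_mul] at hi
    refine mul_left_cancel₀ (h0 i) ?_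
    linear_combination hi
  obtain ⟨h2, h1, h0⟩ := quadratic_eq_zero ht h
  ext q
  fin_cases q <;> simp <;> linarith

theorem det_cos_low_frequencies_ne_zero {k : ℕ} (hk : 4 ≤ k)
    (h0 : Odd k → ∀ i, Real.cos (t i) ≠ 0) :
    (Matrix.of fun q i : Fin 3 =>
      Real.cos ((k - 2 * (k / 2 - (q : ℕ) : ℕ) : ℝ) * t i)).det ≠ 0 := by
  obtain ⟨h, rfl⟩ | ⟨h, rfl⟩ := k.even_or_odd
  · convert det_cos_even_mul_ne_zero ht using 7 with q i
    rw [Nat.cast_sub (by omega), show (h + h) / 2 = h by omega]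
    push_cast
    ring
  · convert det_cos_odd_mul_ne_zero ht (h0 ⟨h, rfl⟩) using 7 with q i
    rw [Nat.cast_sub (by omega), show (2 * h + 1) / 2 = h by omega]
    push_cast
    ring

end Determinants

/-- The determinant of the linear system which three delays impose on the entry of index `k - s` of
a sequence through the cosine sums of order `k`. -/
def delayDet (k s : ℕ) (t : Fin 3 → ℝ) (α : ℕ → ℂ) : ℝ :=
  (Matrix.of ![fun i => Real.cos ((k - 2 * s) * t i), fun i => (cosSum α k (s + 1) (t i)).re,
    fun i => (cosSum α k (s + 1) (t i)).im]).det

theorem ofReal_det_mem {X ι : Type*} [Fintype ι] [DecidableEq ι] {A : StarSubalgebra ℂ (X → ℂ)}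
    {F : X → Matrix ι ι ℝ} (hF : ∀ i j, (fun x => (F x i j : ℂ)) ∈ A) :
    (fun x => ((F x).det : ℂ)) ∈ A := by
  convert sum_mem (S := A) (t := Finset.univ) fun (σ : Equiv.Perm ι) _ =>
    mul_mem (const_mem A (Equiv.Perm.sign σ : ℤ))
      (prod_mem (t := Finset.univ) fun i _ => hF (σ i) i) using 1
  ext x
  simp [Matrix.det_apply']

theorem delayDet_mem_seqPoly {M k s : ℕ} (hM : k ≤ M + s) (t : Fin 3 → ℝ) :
    (fun α => (delayDet k s t α : ℂ)) ∈ seqPoly M := by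
  refine ofReal_det_mem fun i j => ?_
  have hR : (fun α => cosSum α k (s + 1) (t j)) ∈ seqPoly M := cosSum_mem_seqPoly (by omega) _
  fin_cases i
  · exact const_mem _ (Real.cos ((k - 2 * s) * t j) : ℂ)
  · exact ofReal_re_mem hR
  · exact ofReal_im_mem hR

section Generic

variable {k s : ℕ} (hk : 4 + 2 * s ≤ k) {t : Fin 3 → ℝ}
  (ht : Function.Injective fun i => Real.cos (2 * t i))
  (hC : ∀ i, Real.cos ((k - 2 * s) * t i) ≠ 0)

include hk ht hC

theorem exists_det_cos_ne_zero : ∃ l ∈ Finset.Ico (s + 1) (k / 2 + 1),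
    ∃ l' ∈ Finset.Ico (s + 1) (k / 2 + 1),
      (Matrix.of ![fun i => Real.cos ((k - 2 * s) * t i), fun i => Real.cos ((k - 2 * l) * t i),
        fun i => Real.cos ((k - 2 * l') * t i)]).det ≠ 0 := by
  have h0 : Odd k → ∀ i, Real.cos (t i) ≠ 0 := by
    rintro ⟨h, rfl⟩ i h0
    refine hC i ?_
    rw [← cos_odd_mul_eq_zero h0 (h - s), Nat.cast_sub (by omega)]
    push_cast
    ring_nf
  obtain ⟨p, q, hpq⟩ := exists_det_cons_ne_zero
    (det_cos_low_frequencies_ne_zero ht (by omega) h0)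
    (v := fun i => Real.cos ((k - 2 * s) * t i)) fun h => hC 0 (congrFun h 0)
  have ne_s {q : Fin 3} (hq : k / 2 - (q : ℕ) ≠ s) :
      k / 2 - (q : ℕ) ∈ Finset.Ico (s + 1) (k / 2 + 1) := by
    rw [Finset.mem_Ico]
    omega
  refine ⟨_, ne_s (q := p) fun h => hpq ?_, _, ne_s (q := q) fun h => hpq ?_, hpq⟩
  · exact Matrix.det_zero_of_row_eq (show (0 : Fin 3) ≠ 1 by decide) (by ext; simp [h])
  · exact Matrix.det_zero_of_row_eq (show (0 : Fin 3) ≠ 2 by decide) (by ext; simp [h])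

theorem genericSeq_delayDet_ne_zero {M : ℕ} (hM : k ≤ M + s) :
    GenericSeq M fun α => delayDet k s t α ≠ 0 := by
  obtain ⟨l, hl, l', hl', hdet⟩ := exists_det_cos_ne_zero hk ht hC
  obtain ⟨α, h0, h1, hα⟩ := exists_seq_cosSum_eq_two_frequencies (by omega) hl' hl
  refine .of_ofReal (delayDet_mem_seqPoly hM t) ⟨α, h0, h1, fun h => hdet ?_⟩
  simp [delayDet, hα, Matrix.det_fin_three, -Complex.ofReal_cos] at h
  simp [Matrix.det_fin_three]
  linear_combination h / 4

end Generic

section Delays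

variable {ψ : ℝ} (h0 : 0 < ψ) (h1 : ψ < Real.pi / 4)

include h0 h1

theorem sin_nat_mul_ne_zero {n : ℕ} (hn : 0 < n) (hn' : n ≤ 4) : Real.sin (n * ψ) ≠ 0 := by
  have hn4 : (n : ℝ) ≤ 4 := by exact_mod_cast hn'
  exact (Real.sin_pos_of_pos_of_lt_pi (by positivity) (by nlinarith)).ne'

theorem sin_six_mul_ne_zero (h : ψ ≠ Real.pi / 6) : Real.sin ((6 : ℕ) * ψ) ≠ 0 := by
  push_cast
  intro h6
  have h_shift : Real.sin (6 * ψ - Real.pi) = 0 := by rw [Real.sin_sub_pi, h6, neg_zero]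
  have := (Real.sin_eq_zero_iff_of_lt_of_lt (by linarith) (by linarith)).1 h_shift
  exact h (by linarith)

omit h0 h1 in
theorem cos_two_mul_ne {m n : ℕ} (hmn : m ≤ n) (hadd : Real.sin ((m + n : ℕ) * ψ) ≠ 0)
    (hsub : Real.sin ((n - m : ℕ) * ψ) ≠ 0) :
    Real.cos (2 * (m * ψ)) ≠ Real.cos (2 * (n * ψ)) := by
  rw [← sub_ne_zero, ← neg_sub, Real.cos_sub_cos]
  push_cast [hmn] at hadd hsub
  refine neg_ne_zero.2 (mul_ne_zero (mul_ne_zero (by norm_num) ?_) ?_)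
  · convert hadd using 2
    ring
  · convert hsub using 2
    ring

omit h0 h1 in
theorem injective_cos_two_mul {p q : ℕ} (hpq : p ≤ q) (hp : Real.sin (p * ψ) ≠ 0)
    (hq : Real.sin (q * ψ) ≠ 0) (hadd : Real.sin ((p + q : ℕ) * ψ) ≠ 0)
    (hsub : Real.sin ((q - p : ℕ) * ψ) ≠ 0) :
    Function.Injective fun i => Real.cos (2 * ((![0, p, q] i : ℕ) * ψ)) := by
  have h0p := cos_two_mul_ne p.zero_le (by simpa using hp) (by simpa using hp)
  have h0q := cos_two_mul_ne q.zero_le (by simpa using hq) (by simpa using hq)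
  have hpq := cos_two_mul_ne hpq hadd hsub
  intro i j hij
  fin_cases i <;> fin_cases j <;> first
    | rfl
    | exact (h0p hij).elim
    | exact (h0p hij.symm).elim
    | exact (h0q hij).elim
    | exact (h0q hij.symm).elim
    | exact (hpq hij).elim
    | exact (hpq hij.symm).elim

theorem injective_cos_two_mul_fin :
    Function.Injective fun i : Fin 3 => Real.cos (2 * ((i : ℕ) * ψ)) := by
  have hsin {n : ℕ} (hn : 0 < n) (hn' : n ≤ 4) := sin_nat_mul_ne_zero h0 h1 hn hn'
  convert injective_cos_two_mul one_le_two (hsin _ _) (hsin _ _) (hsin _ _) (hsin _ _) with i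
  · fin_cases i <;> rfl
  all_goals norm_num

theorem exists_delays (k : ℕ) (hgood : ¬ (Real.cos (k * ψ) = 0 ∧ ψ = Real.pi / 6)) :
    ∃ m : Fin 3 → ℕ, (∀ i, m i < 5) ∧ (Function.Injective fun i => Real.cos (2 * (m i * ψ))) ∧
      ∀ i, Real.cos (k * (m i * ψ)) ≠ 0 := by
  have hsin {n : ℕ} (hn : 0 < n) (hn' : n ≤ 4) := sin_nat_mul_ne_zero h0 h1 hn hn'
  have h_double : Real.cos (k * (2 * ψ)) = 2 * Real.cos (k * ψ) ^ 2 - 1 := by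
    rw [← Real.cos_two_mul]
    ring_nf
  by_cases hk1 : Real.cos (k * ψ) = 0
  · have h6 := sin_six_mul_ne_zero h0 h1 fun h => hgood ⟨hk1, h⟩
    have hk4 : Real.cos (k * (4 * ψ)) = 1 := by
      rw [show (k : ℝ) * (4 * ψ) = 2 * (k * (2 * ψ)) by ring, Real.cos_two_mul, h_double, hk1]
      norm_num
    refine ⟨![0, 2, 4], by decide, injective_cos_two_mul ?_ (hsin ?_ ?_)
      (hsin ?_ ?_) h6 (hsin ?_ ?_), ?_⟩
    iterate 7 norm_num
    simp [Fin.forall_fin_succ, hk4, h_double, hk1]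
  by_cases hk2 : Real.cos (k * (2 * ψ)) = 0
  · have hk3 : Real.cos (k * (3 * ψ)) = -Real.cos (k * ψ) := by
      rw [show (k : ℝ) * (3 * ψ) = 3 * (k * ψ) by ring, cos_three_mul_eq,
        show 2 * (k * ψ) = k * (2 * ψ) by ring, hk2]
      ring
    refine ⟨![0, 1, 3], by decide, injective_cos_two_mul ?_ (hsin ?_ ?_)
      (hsin ?_ ?_) (hsin ?_ ?_) (hsin ?_ ?_), ?_⟩
    iterate 9 norm_num
    simp [Fin.forall_fin_succ, hk3, hk1]
  · exact ⟨fun i => i, fun i => by dsimp only; omega, injective_cos_two_mul_fin h0 h1,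
      by simp [Fin.forall_fin_succ, one_add_one_eq_two, hk1, hk2]⟩

end Delays

/-- The first five delays do not distinguish `b` from `a`: all cosine sums at the angles `m * ψ`,
`m < 5`, have the same moduli. -/
def SameModuli (M : ℕ) (ψ : ℝ) (b a : ℕ → ℂ) : Prop :=
  ∀ k, 1 ≤ k → k < 2 * M → ∀ m : ℕ, m < 5 → ‖cosSum b k 0 (m * ψ)‖ = ‖cosSum a k 0 (m * ψ)‖

theorem SameModuli.conj {M : ℕ} {ψ : ℝ} {b a : ℕ → ℂ} (h : SameModuli M ψ b a) :
    SameModuli M ψ (fun j => conj (b j)) a := fun k hk hk' m hm => by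
  rw [cosSum_conj, Complex.norm_conj, h k hk hk' m hm]

/-- The normal form of a sequence of length `M + 1` modulo geometric progressions. -/
structure IsNormalized (M : ℕ) (α : ℕ → ℂ) : Prop where
  zero : α 0 = 1
  one : α 1 = 1
  eq_zero : ∀ j, M < j → α j = 0

theorem IsNormalized.conj {M : ℕ} {α : ℕ → ℂ} (h : IsNormalized M α) :
    IsNormalized M fun j => conj (α j) :=
  ⟨by simp [h.zero], by simp [h.one], fun j hj => by simp [h.eq_zero j hj]⟩

/-- The entry of index `k` of a normalized sequence `α` is determined by the preceding entries and
the moduli of the cosine sums. -/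
def EntryDetermined (M : ℕ) (ψ : ℝ) (k : ℕ) (α : ℕ → ℂ) : Prop :=
  ∀ β, IsNormalized M α → IsNormalized M β → (∀ j < k, β j = α j) → SameModuli M ψ β α → β k = α k

theorem cos_mul_normSq_sub_add_re_eq_zero {a b : ℕ → ℂ} {k s : ℕ} (hs : 2 * s < k) (ha : a s = 1)
    (hab : ∀ j < k - s, b j = a j) {t : ℝ} (hC : Real.cos ((k - 2 * s) * t) ≠ 0)
    (h : ‖cosSum b k s t‖ = ‖cosSum a k s t‖) :
    Real.cos ((k - 2 * s) * t) * (Complex.normSq (b (k - s)) - Complex.normSq (a (k - s)))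
      + ((b (k - s) - a (k - s)) * conj (cosSum a k (s + 1) t)).re = 0 := by
  have h_head (x : ℂ) : 2 * (1 * x) * (Real.cos ((k - 2 * s) * t) : ℂ)
      = (2 * Real.cos ((k - 2 * s) * t) : ℝ) * x := by
    push_cast
    ring
  rw [cosSum_eq_add hs, cosSum_eq_add hs, cosSum_congr fun j _ hj => hab j (by omega),
    hab s (by omega), ha, h_head, h_head] at h
  linear_combination (mul_normSq_sub_add_re_eq_zero (mul_ne_zero two_ne_zero hC) h) / 2

theorem genericSeq_eq_of_three_delays {M k s : ℕ} {t : Fin 3 → ℝ} (hk : 4 + 2 * s ≤ k)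
    (hkM : k ≤ M + s) (ht : Function.Injective fun i => Real.cos (2 * t i))
    (hC : ∀ i, Real.cos ((k - 2 * s) * t i) ≠ 0) :
    GenericSeq M fun α => α s = 1 → ∀ β : ℕ → ℂ, (∀ j < k - s, β j = α j) →
      (∀ i, ‖cosSum β k s (t i)‖ = ‖cosSum α k s (t i)‖) → β (k - s) = α (k - s) :=
  (genericSeq_delayDet_ne_zero hk ht hC hkM).mono fun _ _ _ hD hs _ hβ h =>
    sub_eq_zero.1 (eq_zero_of_det_re_im_ne_zero hD fun i =>
      cos_mul_normSq_sub_add_re_eq_zero (by omega) hs hβ (hC i) (h i))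

theorem genericSeq_entryDetermined_of_good {M k : ℕ} {ψ : ℝ} (h0 : 0 < ψ) (h1 : ψ < Real.pi / 4)
    (hk : 4 ≤ k) (hkM : k ≤ M) (hgood : ¬ (Real.cos (k * ψ) = 0 ∧ ψ = Real.pi / 6)) :
    GenericSeq M (EntryDetermined M ψ k) := by
  obtain ⟨m, hm, hinj, hC⟩ := exists_delays h0 h1 k hgood
  refine (genericSeq_eq_of_three_delays (s := 0) hk hkM hinj (by simpa using hC)).mono ?_
  exact fun α h0 _ h β _ _ hβ hsame => h h0 β hβ fun i => hsame k (by omega) (by omega) _ (hm i)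

/-! ### Orders three and four -/

theorem norm_mul_eq_and_re_eq_of_order_two {ψ : ℝ} (h0 : 0 < ψ) (h1 : ψ < Real.pi / 4)
    {a b : ℕ → ℂ} (h : ∀ m : ℕ, m < 5 → ‖cosSum b 2 0 (m * ψ)‖ = ‖cosSum a 2 0 (m * ψ)‖) :
    ‖b 0 * b 2‖ = ‖a 0 * a 2‖ ∧ (b 0 * b 2 * conj (b 1 ^ 2)).re = (a 0 * a 2 * conj (a 1 ^ 2)).re
      ∧ ‖b 1‖ = ‖a 1‖ := by
  have e (a : ℕ → ℂ) (t : ℝ) :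
      cosSum a 2 0 t = 2 * (a 0 * a 2) * (Real.cos (2 * t) : ℂ) + a 1 ^ 2 := by
    rw [cosSum_eq_add (by norm_num), zero_add, ← cosSum_two_mul a 1 t]
    simp
  obtain ⟨h1, h2, h3⟩ := norm_affine_eq (a := 2 * (b 0 * b 2)) (a' := 2 * (a 0 * a 2))
    (b := b 1 ^ 2) (b' := a 1 ^ 2) (injective_cos_two_mul_fin h0 h1) fun i => by
      rw [← e, ← e]
      exact h i (by omega)
  refine ⟨?_, ?_, ?_⟩
  · rw [norm_mul 2, norm_mul 2] at h1
    exact mul_left_cancel₀ (by simp) h1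
  · rw [mul_assoc 2, mul_assoc 2, ← Complex.ofReal_ofNat, Complex.re_ofReal_mul,
      Complex.re_ofReal_mul] at h2
    exact mul_left_cancel₀ two_ne_zero h2
  · rw [norm_pow, norm_pow] at h3
    exact (sq_eq_sq₀ (norm_nonneg _) (norm_nonneg _)).1 h3

section OrdersThreeAndFour

variable {a : ℕ → ℂ} (h0 : a 0 = 1) (h1 : a 1 = 1)

include h0 h1

theorem cosSum_three (t : ℝ) :
    cosSum a 3 0 t = (2 * Real.cos t : ℝ) * (a 3 * ((2 * Real.cos (2 * t) - 1 : ℝ) : ℂ) + a 2) := by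
  rw [cosSum_eq_add (by norm_num), cosSum_eq_add (by norm_num), cosSum_of_lt (by norm_num)]
  simp only [zero_add, Nat.sub_zero, Nat.reduceSub, h0, h1, Nat.cast_zero, Nat.cast_one,
    mul_zero, sub_zero, Nat.cast_ofNat, cos_three_mul_eq]
  rw [show (3 - 2 * 1 : ℝ) * t = t by ring]
  push_cast
  ring

theorem cosSum_four (t : ℝ) :
    cosSum a 4 0 t = ((4 * Real.cos (2 * t) ^ 2 - 2 : ℝ) : ℂ) * a 4
      + ((2 * Real.cos (2 * t) : ℝ) : ℂ) * a 3 + a 2 ^ 2 := by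
  rw [cosSum_eq_add (by norm_num), cosSum_eq_add (by norm_num), ← cosSum_two_mul a 2 t]
  simp only [zero_add, Nat.sub_zero, Nat.reduceSub, h0, h1, Nat.cast_zero, Nat.cast_one,
    mul_zero, sub_zero, Nat.cast_ofNat, cos_four_mul, Nat.reduceMul, Nat.reduceAdd]
  rw [show (4 - 2 * 1 : ℝ) * t = 2 * t by ring]
  push_cast
  ring

theorem eq_or_mul_conj_eq_of_order_three {ψ : ℝ} (hψ0 : 0 < ψ) (hψ1 : ψ < Real.pi / 4)
    {b : ℕ → ℂ} (hb0 : b 0 = 1) (hb1 : b 1 = 1) (h2 : b 2 = a 2) (ha2 : a 2 ≠ 0)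
    (h : ∀ m : ℕ, m < 5 → ‖cosSum b 3 0 (m * ψ)‖ = ‖cosSum a 3 0 (m * ψ)‖) :
    b 3 = a 3 ∨ b 3 * conj (a 2) = conj (a 3 * conj (a 2)) := by
  have hcos (i : Fin 3) : Real.cos ((i : ℕ) * ψ) ≠ 0 := by
    have hi : ((i : ℕ) : ℝ) ≤ 2 := by exact_mod_cast (show (i : ℕ) ≤ 2 by omega)
    have hnn : 0 ≤ (i : ℕ) * ψ := by positivity
    exact (Real.cos_pos_of_mem_Ioo ⟨by linarith, by nlinarith⟩).ne'
  have hinj : Function.Injective fun i : Fin 3 => 2 * Real.cos (2 * ((i : ℕ) * ψ)) - 1 :=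
    ((sub_left_injective (b := 1)).comp (mul_right_injective₀ two_ne_zero)).comp
      (injective_cos_two_mul_fin hψ0 hψ1)
  obtain ⟨h3, hre, -⟩ := norm_affine_eq (a := b 3) (a' := a 3) (b := a 2) (b' := a 2) hinj
    fun i => by
      have := h i (by omega)
      rw [cosSum_three h0 h1, cosSum_three hb0 hb1, h2, norm_mul, norm_mul] at this
      refine mul_left_cancel₀ ?_ this
      rw [norm_ne_zero_iff, Complex.ofReal_ne_zero]
      exact mul_ne_zero two_ne_zero (hcos i)
  have hn : ‖b 3 * conj (a 2)‖ = ‖a 3 * conj (a 2)‖ := by rw [norm_mul, norm_mul, h3]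
  exact (eq_or_eq_conj hn hre).imp_left (mul_right_cancel₀ (by simpa using ha2))

end OrdersThreeAndFour

/-- If `q'` is the reflection of `q` across the line through `p`, the moduli of the cosine sums of
order four force the fourth entries `x` and `y` belonging to `q'` and `q` to satisfy
`q.im * ((x - y) * conj p ^ 2) = thirdShift B C p q y`. -/
def thirdShift (B C : ℝ) (p q y : ℂ) : ℂ :=
  2 * (p * conj q).im * Complex.I *
    ((y * conj p).im + p.im * (C * Complex.normSq p - B * conj q))

/-- A polynomial which vanishes when the reflection of the third entry `q` across the line through
the second entry `p` is compatible with the moduli of the cosine sums of order four; the fourth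
entry is `y`. -/
def thirdObstruction (A B C : ℝ) (p q y : ℂ) : ℝ :=
  Complex.normSq (thirdShift B C p q y + q.im * (y * conj p ^ 2)) - (q.im * Complex.normSq p) ^ 2 *
    (Complex.normSq y - 4 * p.im * (p * conj q).im * A)

section Reflection

variable {p q q' x y : ℂ} (hp : p ≠ 0) (hq : q' * conj p = conj (q * conj p))

theorem eq_of_quadratic_interpolation {A B C X Y Z κ : ℝ} {c : Fin 3 → ℝ}
    (hc : Function.Injective c) (hu : ∀ i, 4 * c i ^ 2 - 2 ≠ 0)
    (hABC : ∀ i, 2 * c i / (4 * c i ^ 2 - 2) = A * (4 * c i ^ 2 - 2) + B + C * (2 * c i))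
    (h : ∀ i, (4 * c i ^ 2 - 2) ^ 2 * X + 2 * (4 * c i ^ 2 - 2) * Y
      + 2 * (4 * c i ^ 2 - 2) * (2 * c i) * Z + 2 * c i * κ = 0) :
    X = -κ * A ∧ 2 * Y = -κ * B ∧ 2 * Z = -κ * C := by
  obtain ⟨h1, h2, h3⟩ := quadratic_eq_zero hc (X := 4 * (X + κ * A)) (Y := 2 * (2 * Z + κ * C))
    (Z := 2 * Y + κ * B - 2 * (X + κ * A)) fun i => by
      refine mul_left_cancel₀ (hu i) ?_
      linear_combination h i - κ * (div_eq_iff (hu i)).1 (hABC i)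
  exact ⟨by linarith, by linarith, by linarith⟩

include hq

theorem im_mul_eq_thirdShift {B C : ℝ}
    (hY : 2 * ((x - y) * conj p ^ 2).re = -(4 * p.im * (p * conj q).im) * B)
    (hZ : 2 * (x * conj q' - y * conj q).re = -(4 * p.im * (p * conj q).im) * C) :
    q.im * ((x - y) * conj p ^ 2) = thirdShift B C p q y := by
  obtain ⟨ω, hω⟩ : ∃ ω, ω = (x - y) * conj p ^ 2 := ⟨_, rfl⟩
  have h_conj : conj q' * p = q * conj p := by simpa using congrArg conj hq
  have h_prod : (x * conj q' - y * conj q) * (Complex.normSq p : ℂ)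
      = ω * q + y * conj p * (conj p * q - p * conj q) := by
    rw [hω, ← Complex.mul_conj]
    linear_combination x * conj p * h_conj
  have h_re := congrArg Complex.re h_prod
  rw [Complex.re_mul_ofReal] at h_re
  rw [← hω] at hY ⊢
  have h_split : q.im * ω = Complex.I * (ω.re * conj q - (ω * q).re) := by
    apply Complex.ext <;> simp <;> ring
  have h_ωq : (ω * q).re
      = -2 * (p * conj q).im * ((y * conj p).im + p.im * C * Complex.normSq p) := by
    simp only [Complex.normSq_apply, Complex.add_re, Complex.mul_re, Complex.sub_re,
      Complex.sub_im, Complex.mul_im, Complex.conj_re, Complex.conj_im] at h_re hZ ⊢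
    linear_combination h_re.symm + (p.re * p.re + p.im * p.im) * hZ / 2
  have h_ω : ω.re = -2 * p.im * (p * conj q).im * B := by linarith
  rw [h_split, h_ωq, h_ω, thirdShift]
  push_cast
  ring

theorem thirdObstruction_eq_zero_of_relations {A B C : ℝ}
    (hX : Complex.normSq x - Complex.normSq y = -(4 * p.im * (p * conj q).im) * A)
    (hY : 2 * ((x - y) * conj p ^ 2).re = -(4 * p.im * (p * conj q).im) * B)
    (hZ : 2 * (x * conj q' - y * conj q).re = -(4 * p.im * (p * conj q).im) * C) :
    thirdObstruction A B C p q y = 0 := by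
  have h_shift : thirdShift B C p q y + q.im * (y * conj p ^ 2) = q.im * (x * conj p ^ 2) := by
    rw [← im_mul_eq_thirdShift hq hY hZ]
    ring
  rw [thirdObstruction, h_shift]
  simp only [map_mul, map_pow, Complex.normSq_conj, Complex.normSq_ofReal]
  linear_combination q.im ^ 2 * Complex.normSq p ^ 2 * hX

include hp

theorem order_four_relation {u v : ℝ}
    (h : ‖u * x + v * q' + p ^ 2‖ = ‖u * y + v * q + p ^ 2‖) :
    u ^ 2 * (Complex.normSq x - Complex.normSq y) + 2 * u * ((x - y) * conj p ^ 2).re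
      + 2 * u * v * (x * conj q' - y * conj q).re + v * (4 * p.im * (p * conj q).im) = 0 := by
  have hN : q'.re ^ 2 + q'.im ^ 2 = q.re ^ 2 + q.im ^ 2 := by
    refine (norm_eq_norm_iff _ _).1 (mul_right_cancel₀ (norm_ne_zero_iff.2 hp) ?_)
    simpa using congrArg norm hq
  have hre := congrArg Complex.re hq
  have him := congrArg Complex.im hq
  have := (norm_eq_norm_iff _ _).1 h
  simp [Complex.normSq_apply, sq] at this hre him ⊢
  linear_combination this - v ^ 2 * hN - 2 * v * (p.re * hre + p.im * him)

theorem thirdObstruction_eq_zero {A B C : ℝ} {c : Fin 3 → ℝ} (hc : Function.Injective c)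
    (hu : ∀ i, 4 * c i ^ 2 - 2 ≠ 0)
    (hABC : ∀ i, 2 * c i / (4 * c i ^ 2 - 2) = A * (4 * c i ^ 2 - 2) + B + C * (2 * c i))
    (h : ∀ i, ‖((4 * c i ^ 2 - 2 : ℝ) : ℂ) * x + ((2 * c i : ℝ) : ℂ) * q' + p ^ 2‖
      = ‖((4 * c i ^ 2 - 2 : ℝ) : ℂ) * y + ((2 * c i : ℝ) : ℂ) * q + p ^ 2‖) :
    thirdObstruction A B C p q y = 0 := by
  obtain ⟨hX, hY, hZ⟩ := eq_of_quadratic_interpolation hc hu hABC fun i =>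
    order_four_relation hp hq (h i)
  exact thirdObstruction_eq_zero_of_relations hq hX hY hZ

theorem im_mul_im_ne_zero (him : p.im ≠ 0) (hne : q' ≠ q) :
    4 * p.im * (p * conj q).im ≠ 0 := by
  refine mul_ne_zero (mul_ne_zero four_ne_zero him) fun hJ => hne ?_
  refine mul_right_cancel₀ (b := conj p) (by simpa using hp) (hq.trans ?_)
  rw [Complex.conj_eq_iff_im]
  simp at hJ ⊢
  linarith

end Reflection

theorem thirdObstruction_mem_seqPoly {M : ℕ} (hM : 5 ≤ M) (A B C : ℝ) :
    (fun α => (thirdObstruction A B C (α 2) (α 3) (α 4) : ℂ)) ∈ seqPoly M := by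
  have hp : (fun α => α 2) ∈ seqPoly M := entry_mem_seqPoly (by omega)
  have hq : (fun α => α 3) ∈ seqPoly M := entry_mem_seqPoly (by omega)
  have hy : (fun α => α 4) ∈ seqPoly M := entry_mem_seqPoly (by omega)
  have hJ := ofReal_im_mem (mul_mem hp (star_mem hq))
  have hP := ofReal_normSq_mem hp
  have hS : (fun α => thirdShift B C (α 2) (α 3) (α 4)) ∈ seqPoly M :=
    mul_mem (mul_mem (mul_mem (const_mem _ 2) hJ) (const_mem _ Complex.I))
      (add_mem (ofReal_im_mem (mul_mem hy (star_mem hp)))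
        (mul_mem (ofReal_im_mem hp) (sub_mem (mul_mem (const_mem _ (C : ℂ)) hP)
          (mul_mem (const_mem _ (B : ℂ)) (star_mem hq)))))
  simp only [thirdObstruction, Complex.ofReal_sub, Complex.ofReal_mul, Complex.ofReal_pow]
  exact sub_mem
    (ofReal_normSq_mem (add_mem hS
      (mul_mem (ofReal_im_mem hq) (mul_mem hy (pow_mem (star_mem hp) 2)))))
    (mul_mem (pow_mem (mul_mem (ofReal_im_mem hq) hP) 2)
      (sub_mem (ofReal_normSq_mem hy)
        (mul_mem (mul_mem (mul_mem (const_mem _ 4) (ofReal_im_mem hp)) hJ) (const_mem _ (A : ℂ)))))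

theorem genericSeq_thirdObstruction_ne_zero {M : ℕ} (hM : 5 ≤ M) (A B C : ℝ) :
    GenericSeq M fun α => thirdObstruction A B C (α 2) (α 3) (α 4) ≠ 0 := by
  let w : ℕ → ℂ := fun j => if j = 2 then Complex.I else if j = 4 then ((C - B + 1 : ℝ) : ℂ) else 1
  refine .of_ofReal (thirdObstruction_mem_seqPoly hM A B C) ⟨w, by simp [w], by simp [w], ?_⟩
  have hw2 : w 2 = Complex.I := rfl
  have hw3 : w 3 = 1 := rfl
  have hw4 : w 4 = (C - B + 1 : ℝ) := rfl
  have h_shift : thirdShift B C (w 2) (w 3) (w 4) = -2 * Complex.I := by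
    simp [hw2, hw3, hw4, thirdShift]
    ring
  rw [thirdObstruction, h_shift, hw3]
  simp

theorem genericSeq_im_two_ne_zero {M : ℕ} (hM : 3 ≤ M) :
    GenericSeq M fun α => (α 2).im ≠ 0 := by
  refine .of_ofReal (ofReal_im_mem (entry_mem_seqPoly (by omega)))
    ⟨fun j => if j = 2 then Complex.I else 1, ?_⟩
  simp

section ThirdEntry

variable {M L : ℕ} (hL : 0 < L) (hLM : 2 * L < M)

include hL hLM

theorem delayAngle_pos : 0 < Real.pi * L / (2 * M) := by
  have : 0 < M := by omega
  positivity

theorem delayAngle_lt : Real.pi * L / (2 * M) < Real.pi / 4 := by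
  have hM : (0 : ℝ) < M := by exact_mod_cast (show 0 < M by omega)
  have hLM : (2 * L : ℝ) < M := by exact_mod_cast hLM
  rw [div_lt_div_iff₀ (by positivity) (by positivity)]
  nlinarith [Real.pi_pos]

theorem entryDetermined_three {α : ℕ → ℂ} {A B C : ℝ} {c : Fin 3 → ℝ}
    (hc : ∀ i, c i = Real.cos (2 * ((i : ℕ) * (Real.pi * L / (2 * M)))))
    (hABC : ∀ i, 2 * c i / (4 * c i ^ 2 - 2) = A * (4 * c i ^ 2 - 2) + B + C * (2 * c i))
    (him : (α 2).im ≠ 0) (hobs : 5 ≤ M → thirdObstruction A B C (α 2) (α 3) (α 4) ≠ 0) :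
    EntryDetermined M (Real.pi * L / (2 * M)) 3 α := by
  intro β hα hβ hlt hsame
  have h_pos := delayAngle_pos hL hLM
  have h_lt := delayAngle_lt hL hLM
  have h2 : β 2 = α 2 := hlt 2 (by omega)
  have hp : α 2 ≠ 0 := fun h => him (by simp [h])
  by_contra hne
  have hq := (eq_or_mul_conj_eq_of_order_three hα.zero hα.one h_pos h_lt hβ.zero hβ.one h2 hp
    (hsame 3 (by omega) (by omega))).resolve_left hne
  have hκ := im_mul_im_ne_zero hp hq him hne
  have h4 (i : Fin 3) : ‖((4 * c i ^ 2 - 2 : ℝ) : ℂ) * β 4 + ((2 * c i : ℝ) : ℂ) * β 3 + α 2 ^ 2‖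
      = ‖((4 * c i ^ 2 - 2 : ℝ) : ℂ) * α 4 + ((2 * c i : ℝ) : ℂ) * α 3 + α 2 ^ 2‖ := by
    have := hsame 4 (by omega) (by omega) i (by omega)
    rwa [cosSum_four hα.zero hα.one, cosSum_four hβ.zero hβ.one, h2, ← hc] at this
  have hu (i : Fin 3) : 4 * c i ^ 2 - 2 ≠ 0 := by
    intro hi
    have h_rel := order_four_relation hp hq (h4 i)
    have hci : c i = 0 := by
      refine eq_zero_of_ne_zero_of_mul_right_eq_zero hκ ?_
      rw [hi] at h_rel
      linear_combination h_rel / 2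
    norm_num [hci] at hi
  obtain h5 | rfl | rfl : 5 ≤ M ∨ M = 4 ∨ M = 3 := by omega
  · refine hobs h5 (thirdObstruction_eq_zero hp hq (fun i j hij => ?_) hu hABC h4)
    exact injective_cos_two_mul_fin h_pos h_lt (by simpa only [hc] using hij)
  · obtain rfl : L = 1 := by omega
    have hc1 : c 1 = √2 / 2 := by
      rw [hc, ← Real.cos_pi_div_four]
      congr 1
      simp
      ring
    exact hu 1 (by norm_num [hc1, div_pow])
  · have h_rel := order_four_relation hp hq (h4 0)
    rw [hα.eq_zero 4 (by omega), hβ.eq_zero 4 (by omega)] at h_rel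
    exact hκ (by simpa [hc] using h_rel)

theorem genericSeq_entryDetermined_three :
    GenericSeq M (EntryDetermined M (Real.pi * L / (2 * M)) 3) := by
  have hinj := injective_cos_two_mul_fin (delayAngle_pos hL hLM) (delayAngle_lt hL hLM)
  set c : Fin 3 → ℝ := fun i => Real.cos (2 * ((i : ℕ) * (Real.pi * L / (2 * M))))
  obtain ⟨a, b, e, h_interp⟩ := exists_quadratic_interpolation hinj fun i =>
    2 * c i / (4 * c i ^ 2 - 2)
  have hABC (i : Fin 3) : 2 * c i / (4 * c i ^ 2 - 2)
      = a / 4 * (4 * c i ^ 2 - 2) + (e + a / 2) + b / 2 * (2 * c i) := by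
    rw [h_interp]
    ring
  have h_obs : GenericSeq M fun α =>
      5 ≤ M → thirdObstruction (a / 4) (e + a / 2) (b / 2) (α 2) (α 3) (α 4) ≠ 0 := by
    by_cases hM : 5 ≤ M
    · exact (genericSeq_thirdObstruction_ne_zero hM _ _ _).mono fun _ _ _ h _ => h
    · exact .of_forall fun _ _ _ h => (hM h).elim
  exact ((genericSeq_im_two_ne_zero (by omega)).and h_obs).mono fun α _ _ h =>
    entryDetermined_three hL hLM (fun _ => rfl) hABC h.1 h.2

end ThirdEntry

/-! ### Consecutive orders at the angle `π / 6` -/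

theorem cos_add_six_mul (j c m : ℕ) :
    Real.cos ((6 * j + c : ℕ) * (m * (Real.pi / 6)))
      = (-1) ^ (j * m) * Real.cos (c * (m * (Real.pi / 6))) := by
  rw [← Real.cos_add_nat_mul_pi]
  push_cast
  ring_nf

theorem cos_two_pi_div_three : Real.cos (2 * Real.pi / 3) = -1 / 2 := by
  rw [mul_div_assoc, Real.cos_two_mul, Real.cos_pi_div_three]
  norm_num

theorem cos_four_pi_div_three : Real.cos (4 * Real.pi / 3) = -1 / 2 := by
  rw [show 4 * Real.pi / 3 = 2 * (2 * Real.pi / 3) by ring, Real.cos_two_mul, cos_two_pi_div_three]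
  norm_num

theorem genericSeq_entryDetermined_last {M j : ℕ} (hj : 1 ≤ j) (hM : M = 6 * j + 3) :
    GenericSeq M (EntryDetermined M (Real.pi / 6) M) := by
  have hinj := injective_cos_two_mul_fin (ψ := Real.pi / 6) (by positivity)
    (by linarith [Real.pi_pos])
  have hC (i : Fin 3) :
      Real.cos (((M + 1 : ℕ) - 2 * (1 : ℕ)) * ((i : ℕ) * (Real.pi / 6))) ≠ 0 := by
    have e : ((M + 1 : ℕ) : ℝ) - 2 * ((1 : ℕ) : ℝ) = (6 * j + 2 : ℕ) := by
      rw [hM]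
      push_cast
      ring
    rw [e, cos_add_six_mul]
    refine mul_ne_zero (pow_ne_zero _ (by norm_num)) ?_
    fin_cases i
    · simp
    · rw [show ((2 : ℕ) * ((1 : ℕ) * (Real.pi / 6)) : ℝ) = Real.pi / 3 by push_cast; ring,
        Real.cos_pi_div_three]
      norm_num
    · rw [show ((2 : ℕ) * ((2 : ℕ) * (Real.pi / 6)) : ℝ) = 2 * Real.pi / 3 by push_cast; ring,
        cos_two_pi_div_three]
      norm_num
  refine (genericSeq_eq_of_three_delays (M := M) (k := M + 1) (s := 1) (by omega) le_rfl hinj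
    hC).mono fun α _ h1 h β hα hβ hlt hsame => h h1 β hlt fun i => ?_
  have := hsame (M + 1) (by omega) (by omega) i (by omega)
  rw [cosSum_eq_add (a := β) (by omega), cosSum_eq_add (a := α) (by omega)] at this
  simpa [hα.eq_zero, hβ.eq_zero] using this

section PairObstruction

theorem exists_eq_mul_I {S σ : ℂ} (hS : S ≠ 0) (h : (σ * conj S).re = 0) :
    ∃ τ : ℝ, σ = τ * (Complex.I * S) := by
  refine ⟨(σ / S).im, ?_⟩
  have h_re : (σ / S).re = 0 := by
    rw [Complex.mul_re, Complex.conj_re, Complex.conj_im, mul_neg, sub_neg_eq_add] at h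
    rw [Complex.div_re, ← add_div, h, zero_div]
  have h_div : σ / S = (σ / S).im * Complex.I := Complex.ext (by simp [h_re]) (by simp)
  rw [← mul_assoc, ← h_div, div_mul_cancel₀ _ hS]

/-- A polynomial which vanishes if the circle through `0` centred at `-z` meets the line orthogonal
to `S` in a nonzero point that is compatible with a nonzero point of the circle through `0` centred
at `-w` on the line orthogonal to `T`; compatible means that the two points, written as
`τ' * (I * S)` and `τ * (I * T)`, satisfy `τ' * D = 2 * τ * D'`. -/
def pairObstruction (D D' : ℝ) (S T w z : ℂ) : ℝ :=
  D * Complex.normSq T * (S * conj z).im - 2 * D' * Complex.normSq S * (T * conj w).im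

theorem mul_normSq_eq_two_mul_im {τ : ℝ} {S z : ℂ} (hτ : τ ≠ 0)
    (h : Complex.normSq (τ * (Complex.I * S)) + 2 * (τ * (Complex.I * S) * conj z).re = 0) :
    τ * Complex.normSq S = 2 * (S * conj z).im := by
  refine mul_left_cancel₀ hτ ?_
  simp [Complex.normSq_apply, -mul_eq_mul_left_iff] at h ⊢
  linear_combination h

theorem eq_zero_of_pairObstruction_ne_zero {D D' τ τ' : ℝ} {S T w z : ℂ} (hτ : τ ≠ 0)
    (hr : τ' * D = 2 * τ * D')
    (hS : Complex.normSq (τ' * (Complex.I * S)) + 2 * (τ' * (Complex.I * S) * conj z).re = 0)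
    (hT : Complex.normSq (τ * (Complex.I * T)) + 2 * (τ * (Complex.I * T) * conj w).re = 0)
    (hne : pairObstruction D D' S T w z ≠ 0) : τ' = 0 := by
  by_contra hτ'
  refine hne ?_
  rw [pairObstruction]
  linear_combination Complex.normSq S * Complex.normSq T / 2 * hr
    - D * Complex.normSq T / 2 * mul_normSq_eq_two_mul_im hτ' hS
    + D' * Complex.normSq S * mul_normSq_eq_two_mul_im hτ hT

theorem eq_zero_of_three_lines {P Q T σ d δ z₁ z₂ w : ℂ} (hD : (P * conj Q).im ≠ 0)
    (hT : T ≠ 0) (hσ : (σ * conj P).re = 0) (hd : (d * conj Q).re = 0) (hδ : (δ * conj T).re = 0)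
    (hrel : σ - d = 2 * δ) (h1 : Complex.normSq σ + 2 * (σ * conj z₁).re = 0)
    (h2 : Complex.normSq d + 2 * (d * conj z₂).re = 0)
    (h3 : Complex.normSq δ + 2 * (δ * conj w).re = 0)
    (hf₁ : pairObstruction (P * conj Q).im (T * conj Q).im P T w z₁ ≠ 0)
    (hf₂ : pairObstruction (P * conj Q).im (T * conj P).im Q T w z₂ ≠ 0) : δ = 0 := by
  have hP : P ≠ 0 := fun h => hD (by simp [h])
  have hQ : Q ≠ 0 := fun h => hD (by simp [h])
  obtain ⟨τ₁, rfl⟩ := exists_eq_mul_I hP hσ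
  obtain ⟨τ₂, rfl⟩ := exists_eq_mul_I hQ hd
  obtain ⟨τ, rfl⟩ := exists_eq_mul_I hT hδ
  by_cases hτ : τ = 0
  · simp [hτ]
  have hrel' : τ₁ * P - τ₂ * Q = 2 * τ * T := by
    refine mul_left_cancel₀ Complex.I_ne_zero ?_
    linear_combination hrel
  have hre := congrArg Complex.re hrel'
  have him := congrArg Complex.im hrel'
  have r1 : τ₁ * (P * conj Q).im = 2 * τ * (T * conj Q).im := by
    simp at hre him ⊢
    linear_combination Q.re * him - Q.im * hre
  have r2 : τ₂ * (P * conj Q).im = 2 * τ * (T * conj P).im := by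
    simp at hre him ⊢
    linear_combination P.re * him - P.im * hre
  have hτ₁ := eq_zero_of_pairObstruction_ne_zero hτ r1 h1 h3 hf₁
  have hτ₂ := eq_zero_of_pairObstruction_ne_zero hτ r2 h2 h3 hf₂
  simpa [hτ₁, hτ₂] using hrel.symm

theorem pairObstruction_add (D D' : ℝ) (S T w z : ℂ) :
    pairObstruction D D' S T w (z + Complex.I * S)
      = pairObstruction D D' S T w z - D * Complex.normSq T * Complex.normSq S := by
  simp [pairObstruction, Complex.normSq_apply]
  ring

theorem pairObstruction_mem {X : Type*} {A : StarSubalgebra ℂ (X → ℂ)} {D D' : X → ℝ}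
    {S T w z : X → ℂ} (hD : (fun x => (D x : ℂ)) ∈ A) (hD' : (fun x => (D' x : ℂ)) ∈ A)
    (hS : S ∈ A) (hT : T ∈ A) (hw : w ∈ A) (hz : z ∈ A) :
    (fun x => (pairObstruction (D x) (D' x) (S x) (T x) (w x) (z x) : ℂ)) ∈ A := by
  simp only [pairObstruction, Complex.ofReal_sub, Complex.ofReal_mul]
  exact sub_mem (mul_mem (mul_mem hD (ofReal_normSq_mem hT))
      (ofReal_im_mem (mul_mem hS (star_mem hz))))
    (mul_mem (mul_mem (mul_mem (const_mem _ 2) hD') (ofReal_normSq_mem hS))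
      (ofReal_im_mem (mul_mem hT (star_mem hw))))

theorem genericSeq_pairObstruction_ne_zero {M K : ℕ} (hK : K < M) (hK2 : 2 ≤ K)
    {D D' : (ℕ → ℂ) → ℝ} {S T w z : (ℕ → ℂ) → ℂ} (hD : (fun α => (D α : ℂ)) ∈ seqPoly K)
    (hD' : (fun α => (D' α : ℂ)) ∈ seqPoly K) (hS : S ∈ seqPoly K) (hT : T ∈ seqPoly K)
    (hw : w ∈ seqPoly K) (hz : z ∈ seqPoly K)
    (hgen : GenericSeq M fun α => D α ≠ 0 ∧ S α ≠ 0 ∧ T α ≠ 0) :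
    GenericSeq M fun α => pairObstruction (D α) (D' α) (S α) (T α) (w α) (α K + z α) ≠ 0 := by
  have hle := seqPoly_mono hK.le
  refine .of_ofReal (pairObstruction_mem (hle hD) (hle hD') (hle hS) (hle hT) (hle hw)
    (add_mem (entry_mem_seqPoly hK) (hle hz))) ?_
  obtain ⟨α, h0, h1, hDα, hSα, hTα⟩ := hgen.exists_seq
  by_cases hα : pairObstruction (D α) (D' α) (S α) (T α) (w α) (α K + z α) = 0
  · let β := Function.update α K (α K + Complex.I * S α)
    have h_agree : ∀ j < K, β j = α j := fun j hj => Function.update_of_ne hj.ne _ _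
    have eD : D β = D α := Complex.ofReal_injective (eq_of_mem_seqPoly hD h_agree)
    have eD' : D' β = D' α := Complex.ofReal_injective (eq_of_mem_seqPoly hD' h_agree)
    have eK : β K = α K + Complex.I * S α := Function.update_self ..
    refine ⟨β, (h_agree 0 (by omega)).trans h0, (h_agree 1 (by omega)).trans h1, ?_⟩
    rw [eD, eD', eq_of_mem_seqPoly hS h_agree, eq_of_mem_seqPoly hT h_agree,
      eq_of_mem_seqPoly hw h_agree, eq_of_mem_seqPoly hz h_agree, eK, add_right_comm,
      pairObstruction_add, hα, zero_sub]
    simp [hDα, hSα, hTα]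
  · exact ⟨α, h0, h1, hα⟩

end PairObstruction

section Deviations

variable {α β : ℕ → ℂ} (h0 : α 0 = 1) (h1 : α 1 = 1) {k : ℕ} {t : ℝ}

include h0

include h1 in
theorem cosSum_eq_top_pair (hk : 4 ≤ k) {u η : ℝ} (hu : Real.cos (k * t) = u)
    (hη : Real.cos ((k - 2 : ℝ) * t) = η * u) :
    cosSum α k 0 t = (2 * u : ℝ) * (α k + η * α (k - 1)) + cosSum α k 2 t := by
  rw [cosSum_eq_add (by omega), cosSum_eq_add (by omega)]
  simp only [zero_add, Nat.sub_zero, Nat.cast_zero, mul_zero, sub_zero, Nat.cast_one, mul_one, hu,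
    hη, h0, h1]
  push_cast
  ring

include h1 in
theorem mul_normSq_top_pair_sub_add_re_eq_zero (hk : 4 ≤ k) (hβ : ∀ i < k - 1, β i = α i)
    {u η : ℝ} (hu0 : u ≠ 0) (hu : Real.cos (k * t) = u)
    (hη : Real.cos ((k - 2 : ℝ) * t) = η * u) (h : ‖cosSum β k 0 t‖ = ‖cosSum α k 0 t‖) :
    u * (Complex.normSq (β k + η * β (k - 1)) - Complex.normSq (α k + η * α (k - 1)))
      + ((β k + η * β (k - 1) - (α k + η * α (k - 1))) * conj (cosSum α k 2 t)).re = 0 := by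
  rw [cosSum_eq_top_pair ((hβ 0 (by omega)).trans h0) ((hβ 1 (by omega)).trans h1) hk hu hη,
    cosSum_eq_top_pair h0 h1 hk hu hη, cosSum_congr fun i _ hi => hβ i (by omega)] at h
  linear_combination (mul_normSq_sub_add_re_eq_zero (mul_ne_zero two_ne_zero hu0) h) / 2

omit h0 in
theorem normSq_sub_add_two_mul_re_eq_zero {a b R : ℂ} {u : ℝ} (hu : u ^ 2 = 1)
    (h : u * (Complex.normSq b - Complex.normSq a) + ((b - a) * conj R).re = 0) :
    Complex.normSq (b - a) + 2 * ((b - a) * conj (a + u * R / 2)).re = 0 := by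
  obtain ⟨θ, rfl⟩ : ∃ θ : ℝ, u = 2 * θ := ⟨u / 2, by ring⟩
  have h_half : ((2 * θ : ℝ) : ℂ) * R / 2 = θ * R := by
    push_cast
    ring
  rw [h_half]
  simp [Complex.normSq_apply] at h ⊢
  linear_combination 2 * θ * h - (b.re ^ 2 + b.im ^ 2 - a.re ^ 2 - a.im ^ 2) * hu

end Deviations

section ConsecutiveOrders

/-- A combination of the inner cosine sums of order `6 * j + 4` at even multiples of `π / 6`,
chosen so that the deviation of a second solution is orthogonal to it. -/
def evenComb (α : ℕ → ℂ) (j : ℕ) : ℂ :=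
  cosSum α (6 * j + 4) 2 ((0 : ℕ) * (Real.pi / 6))
    + 2 * cosSum α (6 * j + 4) 2 ((2 : ℕ) * (Real.pi / 6))

/-- The analogue of `evenComb` at odd multiples of `π / 6`. -/
def oddComb (α : ℕ → ℂ) (j : ℕ) : ℂ :=
  cosSum α (6 * j + 4) 2 ((3 : ℕ) * (Real.pi / 6))
    + 2 * cosSum α (6 * j + 4) 2 ((1 : ℕ) * (Real.pi / 6))

/-- The analogue of `evenComb` for the order `6 * j + 3`. -/
def lowComb (α : ℕ → ℂ) (j : ℕ) : ℂ :=
  cosSum α (6 * j + 3) 1 ((0 : ℕ) * (Real.pi / 6))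
    + cosSum α (6 * j + 3) 1 ((2 : ℕ) * (Real.pi / 6))

/-- Up to the summand `α (6 * j + 4)` and the sign, the centre of the circle through `0` containing
the deviation of a second solution at even multiples of `π / 6`. -/
def evenCenter (α : ℕ → ℂ) (j : ℕ) : ℂ :=
  α (6 * j + 3) + cosSum α (6 * j + 4) 2 ((0 : ℕ) * (Real.pi / 6)) / 2

/-- The analogue of `evenCenter` at odd multiples of `π / 6`. -/
def oddCenter (α : ℕ → ℂ) (j : ℕ) : ℂ :=
  -α (6 * j + 3) + (-1) ^ j * cosSum α (6 * j + 4) 2 ((3 : ℕ) * (Real.pi / 6)) / 2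

/-- The analogue of `evenCenter` for the order `6 * j + 3`. -/
def lowCenter (α : ℕ → ℂ) (j : ℕ) : ℂ :=
  α (6 * j + 3) + cosSum α (6 * j + 3) 1 ((0 : ℕ) * (Real.pi / 6)) / 2

theorem evenComb_mem_seqPoly (j : ℕ) : (fun α => evenComb α j) ∈ seqPoly (6 * j + 4) :=
  add_mem (cosSum_mem_seqPoly (by omega) _)
    (mul_mem (const_mem _ 2) (cosSum_mem_seqPoly (by omega) _))

theorem oddComb_mem_seqPoly (j : ℕ) : (fun α => oddComb α j) ∈ seqPoly (6 * j + 4) :=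
  add_mem (cosSum_mem_seqPoly (by omega) _)
    (mul_mem (const_mem _ 2) (cosSum_mem_seqPoly (by omega) _))

theorem lowComb_mem_seqPoly (j : ℕ) : (fun α => lowComb α j) ∈ seqPoly (6 * j + 4) :=
  add_mem (cosSum_mem_seqPoly (by omega) _) (cosSum_mem_seqPoly (by omega) _)

theorem evenCenter_mem_seqPoly (j : ℕ) : (fun α => evenCenter α j) ∈ seqPoly (6 * j + 4) := by
  simp only [evenCenter, div_eq_mul_inv _ (2 : ℂ)]
  exact add_mem (entry_mem_seqPoly (by omega))
    (mul_mem (cosSum_mem_seqPoly (by omega) _) (const_mem _ _))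

theorem oddCenter_mem_seqPoly (j : ℕ) : (fun α => oddCenter α j) ∈ seqPoly (6 * j + 4) := by
  simp only [oddCenter, div_eq_mul_inv _ (2 : ℂ)]
  exact add_mem (neg_mem (entry_mem_seqPoly (by omega)))
    (mul_mem (mul_mem (const_mem _ _) (cosSum_mem_seqPoly (by omega) _)) (const_mem _ _))

theorem lowCenter_mem_seqPoly (j : ℕ) : (fun α => lowCenter α j) ∈ seqPoly (6 * j + 4) := by
  simp only [lowCenter, div_eq_mul_inv _ (2 : ℂ)]
  exact add_mem (entry_mem_seqPoly (by omega))
    (mul_mem (cosSum_mem_seqPoly (by omega) _) (const_mem _ _))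

theorem genericSeq_evenComb_mul_conj_oddComb_im_ne_zero {M j : ℕ} (hj : 1 ≤ j)
    (hM : 6 * j + 4 ≤ M) :
    GenericSeq M fun α => (evenComb α j * conj (oddComb α j)).im ≠ 0 := by
  refine .of_ofReal (seqPoly_mono hM (ofReal_im_mem (mul_mem (evenComb_mem_seqPoly j)
    (star_mem (oddComb_mem_seqPoly j))))) ?_
  obtain ⟨α, h0, h1, hα⟩ := exists_seq_cosSum_eq_two_frequencies (k := 6 * j + 4) (i := 2)
    (l := 3 * j + 2) (l' := 3 * j - 1) (by omega) (Finset.mem_Ico.2 (by omega))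
    (Finset.mem_Ico.2 (by omega))
  refine ⟨α, h0, h1, ?_⟩
  have h_sum (m : ℕ) : cosSum α (6 * j + 4) 2 (m * (Real.pi / 6))
      = 2 * (-1) ^ m + 2 * Complex.I := by
    have e1 : (((6 * j + 4 : ℕ) : ℝ) - 2 * ((3 * j - 1 : ℕ) : ℝ)) * (m * (Real.pi / 6))
        = m * Real.pi := by
      rw [Nat.cast_sub (by omega)]
      push_cast
      ring
    have e2 : (((6 * j + 4 : ℕ) : ℝ) - 2 * ((3 * j + 2 : ℕ) : ℝ)) * (m * (Real.pi / 6)) = 0 := by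
      push_cast
      ring
    rw [hα, e1, e2, Real.cos_nat_mul_pi, Real.cos_zero]
    push_cast
    ring
  rw [evenComb, oddComb, h_sum, h_sum, h_sum, h_sum]
  norm_num [pow_succ]

theorem genericSeq_lowComb_ne_zero {M j : ℕ} (hj : 1 ≤ j) (hM : 6 * j + 4 ≤ M) :
    GenericSeq M fun α => lowComb α j ≠ 0 := by
  obtain ⟨α, h0, h1, hα⟩ := exists_seq_cosSum_eq_two_frequencies (k := 6 * j + 3) (i := 1)
    (l := 2) (l' := 1) (by omega) (Finset.mem_Ico.2 (by omega)) (Finset.mem_Ico.2 (by omega))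
  refine ⟨_, seqPoly_mono hM (lowComb_mem_seqPoly j), ⟨α, h0, h1, ?_⟩, fun _ _ _ h => h⟩
  have e1 : (((6 * j + 3 : ℕ) : ℝ) - 2 * ((1 : ℕ) : ℝ)) * ((2 : ℕ) * (Real.pi / 6))
      = Real.pi / 3 + j * (2 * Real.pi) := by
    push_cast
    ring
  have e2 : (((6 * j + 3 : ℕ) : ℝ) - 2 * ((2 : ℕ) : ℝ)) * ((2 : ℕ) * (Real.pi / 6))
      = -(Real.pi / 3) + j * (2 * Real.pi) := by
    push_cast
    ring
  rw [lowComb, hα, hα, e1, e2, Real.cos_add_nat_mul_two_pi, Real.cos_add_nat_mul_two_pi,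
    Real.cos_neg, Real.cos_pi_div_three]
  refine fun h => ?_
  have := congrArg Complex.re h
  norm_num at this

/-- The genericity conditions under which the orders `6 * j + 3` and `6 * j + 4` together determine
the entry `6 * j + 3` at the angle `π / 6`. -/
structure PairNondegenerate (j : ℕ) (α : ℕ → ℂ) : Prop where
  im_ne_zero : (evenComb α j * conj (oddComb α j)).im ≠ 0
  lowComb_ne_zero : lowComb α j ≠ 0
  even : pairObstruction
    (evenComb α j * conj (oddComb α j)).im (lowComb α j * conj (oddComb α j)).im
    (evenComb α j) (lowComb α j) (lowCenter α j) (α (6 * j + 4) + evenCenter α j) ≠ 0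
  odd : pairObstruction
    (evenComb α j * conj (oddComb α j)).im (lowComb α j * conj (evenComb α j)).im
    (oddComb α j) (lowComb α j) (lowCenter α j) (α (6 * j + 4) + oddCenter α j) ≠ 0

theorem genericSeq_pairNondegenerate {M j : ℕ} (hj : 1 ≤ j) (hM : 6 * j + 4 < M) :
    GenericSeq M (PairNondegenerate j) := by
  have hP := evenComb_mem_seqPoly j
  have hQ := oddComb_mem_seqPoly j
  have hT := lowComb_mem_seqPoly j
  have hPQ := ofReal_im_mem (mul_mem hP (star_mem hQ))
  have h_im := genericSeq_evenComb_mul_conj_oddComb_im_ne_zero hj hM.le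
  have h_low := genericSeq_lowComb_ne_zero hj hM.le
  have h_even := genericSeq_pairObstruction_ne_zero hM (by omega) hPQ
    (ofReal_im_mem (mul_mem hT (star_mem hQ))) hP hT (lowCenter_mem_seqPoly j)
    (evenCenter_mem_seqPoly j) ((h_im.and h_low).mono fun α _ _ h =>
      ⟨h.1, left_ne_zero_of_mul fun h' => h.1 (by rw [h', Complex.zero_im]), h.2⟩)
  have h_odd := genericSeq_pairObstruction_ne_zero hM (by omega) hPQ
    (ofReal_im_mem (mul_mem hT (star_mem hP))) hQ hT (lowCenter_mem_seqPoly j)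
    (oddCenter_mem_seqPoly j) ((h_im.and h_low).mono fun α _ _ h =>
      ⟨h.1, fun h' => h.1 (by simp [h']), h.2⟩)
  exact ((h_im.and h_low).and (h_even.and h_odd)).mono fun α _ _ h =>
    ⟨h.1.1, h.1.2, h.2.1, h.2.2⟩

variable {α β : ℕ → ℂ} {j : ℕ} (h0 : α 0 = 1) (h1 : α 1 = 1)
  (hβ : ∀ i < 6 * j + 3, β i = α i)

include h0 hβ

theorem low_deviation
    (h : ∀ m : ℕ, m < 5 → ‖cosSum β (6 * j + 3) 0 (m * (Real.pi / 6))‖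
      = ‖cosSum α (6 * j + 3) 0 (m * (Real.pi / 6))‖) :
    ((β (6 * j + 3) - α (6 * j + 3)) * conj (lowComb α j)).re = 0 ∧
      Complex.normSq (β (6 * j + 3) - α (6 * j + 3))
        + 2 * ((β (6 * j + 3) - α (6 * j + 3)) * conj (lowCenter α j)).re = 0 := by
  have relation (m : ℕ) (hm : m < 5) {C : ℝ} (hC : C ≠ 0)
      (hcos : Real.cos ((6 * j + 3 : ℕ) * (m * (Real.pi / 6))) = C) :
      C * (Complex.normSq (β (6 * j + 3)) - Complex.normSq (α (6 * j + 3)))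
        + ((β (6 * j + 3) - α (6 * j + 3))
          * conj (cosSum α (6 * j + 3) 1 (m * (Real.pi / 6)))).re = 0 := by
    have := cos_mul_normSq_sub_add_re_eq_zero (k := 6 * j + 3) (s := 0) (by omega) h0 hβ
      (t := m * (Real.pi / 6))
    simp only [Nat.cast_zero, mul_zero, sub_zero, hcos] at this
    exact this hC (h m hm)
  have r0 := relation 0 (by norm_num) one_ne_zero (by simp)
  have r2 := relation 2 (by norm_num) (C := -1) (by norm_num) (by
    rw [cos_add_six_mul, show ((3 : ℕ) : ℝ) * ((2 : ℕ) * (Real.pi / 6)) = Real.pi by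
      push_cast; ring, Real.cos_pi, mul_comm j, pow_mul, neg_one_sq, one_pow, one_mul])
  constructor
  · rw [lowComb, map_add, mul_add, Complex.add_re]
    linear_combination r0 + r2
  · simpa [lowCenter] using normSq_sub_add_two_mul_re_eq_zero (one_pow 2) r0

variable (h : ∀ m : ℕ, m < 5 → ‖cosSum β (6 * j + 4) 0 (m * (Real.pi / 6))‖
  = ‖cosSum α (6 * j + 4) 0 (m * (Real.pi / 6))‖)

include h1 h

theorem pair_relation (hj : 1 ≤ j) {m : ℕ} (hm : m < 5) {u η : ℝ} (hu0 : u ≠ 0)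
    (hu : Real.cos ((6 * j + 4 : ℕ) * (m * (Real.pi / 6))) = u)
    (hη : Real.cos ((6 * j + 2 : ℕ) * (m * (Real.pi / 6))) = η * u) :
    u * (Complex.normSq (β (6 * j + 4) + η * β (6 * j + 3))
        - Complex.normSq (α (6 * j + 4) + η * α (6 * j + 3)))
      + ((β (6 * j + 4) + η * β (6 * j + 3) - (α (6 * j + 4) + η * α (6 * j + 3)))
        * conj (cosSum α (6 * j + 4) 2 (m * (Real.pi / 6)))).re = 0 := by
  refine mul_normSq_top_pair_sub_add_re_eq_zero h0 h1 (by omega) hβ hu0 hu ?_ (h m hm)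
  rw [← hη]
  push_cast
  ring_nf

theorem even_deviation (hj : 1 ≤ j) :
    ((β (6 * j + 4) + β (6 * j + 3) - (α (6 * j + 4) + α (6 * j + 3)))
        * conj (evenComb α j)).re = 0 ∧
      Complex.normSq (β (6 * j + 4) + β (6 * j + 3) - (α (6 * j + 4) + α (6 * j + 3)))
        + 2 * ((β (6 * j + 4) + β (6 * j + 3) - (α (6 * j + 4) + α (6 * j + 3)))
          * conj (α (6 * j + 4) + evenCenter α j)).re = 0 := by
  have relation {m : ℕ} (hm : m < 5) {u : ℝ} := pair_relation h0 h1 hβ h hj hm (u := u) (η := 1)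
  simp only [Complex.ofReal_one, one_mul] at relation
  have r0 := relation (m := 0) (u := 1) (by norm_num) one_ne_zero (by simp) (by simp)
  have r2 := relation (m := 2) (u := -1 / 2) (by norm_num) (by norm_num)
    (by
      rw [cos_add_six_mul, show ((4 : ℕ) : ℝ) * ((2 : ℕ) * (Real.pi / 6)) = 4 * Real.pi / 3 by
        push_cast; ring, cos_four_pi_div_three, mul_comm j, pow_mul, neg_one_sq, one_pow, one_mul])
    (by
      rw [cos_add_six_mul, show ((2 : ℕ) : ℝ) * ((2 : ℕ) * (Real.pi / 6)) = 2 * Real.pi / 3 by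
        push_cast; ring, cos_two_pi_div_three, mul_comm j, pow_mul, neg_one_sq, one_pow, one_mul])
  constructor
  · rw [evenComb, map_add, mul_add, Complex.add_re, map_mul, mul_left_comm, Complex.conj_ofNat,
      two_mul, Complex.add_re]
    linear_combination r0 + 2 * r2
  · simpa [evenCenter, add_assoc] using normSq_sub_add_two_mul_re_eq_zero (one_pow 2) r0

theorem odd_deviation (hj : 1 ≤ j) :
    ((β (6 * j + 4) - β (6 * j + 3) - (α (6 * j + 4) - α (6 * j + 3)))
        * conj (oddComb α j)).re = 0 ∧
      Complex.normSq (β (6 * j + 4) - β (6 * j + 3) - (α (6 * j + 4) - α (6 * j + 3)))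
        + 2 * ((β (6 * j + 4) - β (6 * j + 3) - (α (6 * j + 4) - α (6 * j + 3)))
          * conj (α (6 * j + 4) + oddCenter α j)).re = 0 := by
  have relation {m : ℕ} (hm : m < 5) {u : ℝ} := pair_relation h0 h1 hβ h hj hm (u := u) (η := -1)
  simp only [Complex.ofReal_neg, Complex.ofReal_one, neg_one_mul, ← sub_eq_add_neg] at relation
  have hε : ((-1 : ℝ) ^ j) ^ 2 = 1 := by rw [← pow_mul, mul_comm, pow_mul, neg_one_sq, one_pow]
  have hε0 : (-1 : ℝ) ^ j ≠ 0 := pow_ne_zero _ (by norm_num)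
  have hε3 : (-1 : ℝ) ^ (j * 3) = (-1) ^ j := by
    rw [pow_mul]
    linear_combination (-1) ^ j * hε
  have r1 := relation (m := 1) (u := -(-1) ^ j / 2) (by norm_num)
    (div_ne_zero (neg_ne_zero.2 hε0) two_ne_zero)
    (by
      rw [cos_add_six_mul, show ((4 : ℕ) : ℝ) * ((1 : ℕ) * (Real.pi / 6)) = 2 * Real.pi / 3 by
        push_cast; ring, cos_two_pi_div_three, mul_one]
      ring)
    (by
      rw [cos_add_six_mul, show ((2 : ℕ) : ℝ) * ((1 : ℕ) * (Real.pi / 6)) = Real.pi / 3 by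
        push_cast; ring, Real.cos_pi_div_three, mul_one]
      ring)
  have r3 := relation (m := 3) (u := (-1) ^ j) (by norm_num) hε0
    (by
      rw [cos_add_six_mul, show ((4 : ℕ) : ℝ) * ((3 : ℕ) * (Real.pi / 6)) = 2 * Real.pi by
        push_cast; ring, Real.cos_two_pi, hε3, mul_one])
    (by
      rw [cos_add_six_mul, show ((2 : ℕ) : ℝ) * ((3 : ℕ) * (Real.pi / 6)) = Real.pi by
        push_cast; ring, Real.cos_pi, hε3, mul_neg_one])
  constructor
  · rw [oddComb, map_add, mul_add, Complex.add_re, map_mul, mul_left_comm, Complex.conj_ofNat,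
      two_mul, Complex.add_re]
    linear_combination r3 + 2 * r1
  · simpa [oddCenter, sub_eq_add_neg, add_assoc] using normSq_sub_add_two_mul_re_eq_zero hε r3

end ConsecutiveOrders

theorem eq_of_pairNondegenerate {α β : ℕ → ℂ} {j : ℕ} (h0 : α 0 = 1) (h1 : α 1 = 1) (hj : 1 ≤ j)
    (hβ : ∀ i < 6 * j + 3, β i = α i)
    (h_low : ∀ m : ℕ, m < 5 → ‖cosSum β (6 * j + 3) 0 (m * (Real.pi / 6))‖
      = ‖cosSum α (6 * j + 3) 0 (m * (Real.pi / 6))‖)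
    (h_high : ∀ m : ℕ, m < 5 → ‖cosSum β (6 * j + 4) 0 (m * (Real.pi / 6))‖
      = ‖cosSum α (6 * j + 4) 0 (m * (Real.pi / 6))‖)
    (hα : PairNondegenerate j α) : β (6 * j + 3) = α (6 * j + 3) := by
  obtain ⟨low_line, low_circle⟩ := low_deviation h0 hβ h_low
  obtain ⟨even_line, even_circle⟩ := even_deviation h0 h1 hβ h_high hj
  obtain ⟨odd_line, odd_circle⟩ := odd_deviation h0 h1 hβ h_high hj
  exact sub_eq_zero.1 (eq_zero_of_three_lines hα.im_ne_zero hα.lowComb_ne_zero even_line odd_line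
    low_line (by ring) even_circle odd_circle low_circle hα.even hα.odd)

theorem genericSeq_entryDetermined_degenerate {M j : ℕ} (hj : 1 ≤ j) (hM : 6 * j + 4 < M) :
    GenericSeq M (EntryDetermined M (Real.pi / 6) (6 * j + 3)) :=
  (genericSeq_pairNondegenerate hj hM).mono fun _ h0 h1 h _ _ _ hβ hsame =>
    eq_of_pairNondegenerate h0 h1 hj hβ (hsame _ (by omega) (by omega))
      (hsame _ (by omega) (by omega)) h

/-! ### Determination up to conjugation -/

section Determination

variable {M L k : ℕ}

theorem exists_eq_of_cos_mul_pi_div_six_eq_zero (h : Real.cos (k * (Real.pi / 6)) = 0) :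
    ∃ j, k = 6 * j + 3 := by
  obtain ⟨n, hn⟩ := Real.cos_eq_zero_iff.1 h
  have hk : (k : ℝ) = 3 * (2 * n + 1) := by
    refine mul_left_cancel₀ Real.pi_ne_zero ?_
    linarith
  have hk : (k : ℤ) = 3 * (2 * n + 1) := by exact_mod_cast hk
  exact ⟨n.toNat, by omega⟩

variable (hL : 0 < L) (hLM : 2 * L < M)

include hL hLM

omit hL in
theorem eq_three_mul_of_delayAngle_eq (h : Real.pi * L / (2 * M) = Real.pi / 6) : M = 3 * L := by
  have hM : (0 : ℝ) < M := by exact_mod_cast (show 0 < M by omega)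
  rw [div_eq_div_iff (by positivity) (by norm_num)] at h
  have : (M : ℝ) = 3 * L := by
    refine mul_left_cancel₀ Real.pi_ne_zero ?_
    linarith
  exact_mod_cast this

theorem genericSeq_entryDetermined (hk : 3 ≤ k) (hkM : k ≤ M) :
    GenericSeq M (EntryDetermined M (Real.pi * L / (2 * M)) k) := by
  obtain rfl | hk := hk.eq_or_lt
  · exact genericSeq_entryDetermined_three hL hLM
  by_cases hbad : Real.cos (k * (Real.pi * L / (2 * M))) = 0 ∧
      Real.pi * L / (2 * M) = Real.pi / 6
  · obtain ⟨hcos, hψ⟩ := hbad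
    have hML := eq_three_mul_of_delayAngle_eq hLM hψ
    rw [hψ] at hcos ⊢
    obtain ⟨j, rfl⟩ := exists_eq_of_cos_mul_pi_div_six_eq_zero hcos
    obtain h | h := hkM.eq_or_lt
    · rw [h]
      exact genericSeq_entryDetermined_last (by omega) h.symm
    · exact genericSeq_entryDetermined_degenerate (by omega) (by omega)
  · exact genericSeq_entryDetermined_of_good (delayAngle_pos hL hLM) (delayAngle_lt hL hLM)
      hk hkM hbad

end Determination

theorem eq_of_entryDetermined {M : ℕ} {ψ : ℝ} {α β : ℕ → ℂ} (hα : IsNormalized M α)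
    (hβ : IsNormalized M β) (h : SameModuli M ψ β α) (h2 : β 2 = α 2)
    (hdet : ∀ k ∈ Finset.Icc 3 M, EntryDetermined M ψ k α) (j : ℕ) : β j = α j := by
  induction j using Nat.strong_induction_on with
  | _ j ih =>
    obtain rfl | rfl | rfl | hj : j = 0 ∨ j = 1 ∨ j = 2 ∨ 3 ≤ j := by omega
    · rw [hα.zero, hβ.zero]
    · rw [hα.one, hβ.one]
    · exact h2
    · obtain hjM | hjM := le_or_gt j M
      · exact hdet j (Finset.mem_Icc.2 ⟨hj, hjM⟩) β hα hβ ih h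
      · rw [hα.eq_zero j hjM, hβ.eq_zero j hjM]

/-- A normalized sequence `α` is determined up to conjugation, among the normalized sequences, by
the moduli of its cosine sums at the first five delays. -/
def DeterminedUpToConj (M : ℕ) (ψ : ℝ) (α : ℕ → ℂ) : Prop :=
  ∀ β, IsNormalized M α → IsNormalized M β → SameModuli M ψ β α →
    (∀ j, β j = α j) ∨ ∀ j, β j = conj (α j)

theorem genericSeq_determinedUpToConj {M L : ℕ} (hL : 0 < L) (hLM : 2 * L < M) :
    GenericSeq M (DeterminedUpToConj M (Real.pi * L / (2 * M))) := by
  refine (GenericSeq.ball (Finset.Icc 3 M) fun k hk => genericSeq_entryDetermined hL hLM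
    (Finset.mem_Icc.1 hk).1 (Finset.mem_Icc.1 hk).2).mono ?_
  intro α _ _ hdet β hα hβ hsame
  have h_order_two := norm_mul_eq_and_re_eq_of_order_two (delayAngle_pos hL hLM)
    (delayAngle_lt hL hLM) (hsame 2 (by omega) (by omega))
  simp only [hα.zero, hα.one, hβ.zero, hβ.one, one_mul, one_pow, map_one, mul_one] at h_order_two
  obtain h2 | h2 := eq_or_eq_conj h_order_two.1 h_order_two.2.1
  · exact .inl (eq_of_entryDetermined hα hβ hsame h2 hdet)
  · refine .inr fun j => ?_
    rw [← eq_of_entryDetermined hα hβ.conj hsame.conj (by simp [h2]) hdet j, Complex.conj_conj]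

section Normalization

variable {a b : ℕ → ℂ}

/-- The sequence `a`, multiplied by the geometric progression that makes it start with `1, 1`. -/
def normalizeSeq (a : ℕ → ℂ) (j : ℕ) : ℂ := (a 0)⁻¹ * (a 0 / a 1) ^ j * a j

theorem isNormalized_normalizeSeq {M : ℕ} (ha : ∀ j, M < j → a j = 0) (h0 : a 0 ≠ 0)
    (h1 : a 1 ≠ 0) : IsNormalized M (normalizeSeq a) where
  zero := by simp [normalizeSeq, h0]
  one := by
    simp only [normalizeSeq, pow_one]
    field_simp
  eq_zero j hj := by simp [normalizeSeq, ha j hj]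

theorem conj_normalizeSeq (a : ℕ → ℂ) (j : ℕ) :
    conj (normalizeSeq a j) = normalizeSeq (fun i => conj (a i)) j := by
  simp [normalizeSeq]

theorem eq_mul_normalizeSeq (h0 : a 0 ≠ 0) (h1 : a 1 ≠ 0) (j : ℕ) :
    a j = a 0 * (a 1 / a 0) ^ j * normalizeSeq a j := by
  rw [normalizeSeq, div_pow, div_pow]
  field_simp

/-- `b` is the product of `a` and a geometric progression in the unit circle. -/
def IsTwist (b a : ℕ → ℂ) : Prop :=
  ∃ x y : ℂ, ‖x‖ = 1 ∧ ‖y‖ = 1 ∧ ∀ j, b j = x * y ^ j * a j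

theorem isTwist_of_normalizeSeq_eq (ha0 : a 0 ≠ 0) (ha1 : a 1 ≠ 0) (h0 : ‖b 0‖ = ‖a 0‖)
    (h1 : ‖b 1‖ = ‖a 1‖) (h : ∀ j, normalizeSeq b j = normalizeSeq a j) : IsTwist b a := by
  have hb0 : b 0 ≠ 0 := by rwa [← norm_ne_zero_iff, h0, norm_ne_zero_iff]
  have hb1 : b 1 ≠ 0 := by rwa [← norm_ne_zero_iff, h1, norm_ne_zero_iff]
  refine ⟨b 0 / a 0, (b 1 / b 0) / (a 1 / a 0), ?_, ?_, fun j => ?_⟩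
  · rw [norm_div, h0, div_self (norm_ne_zero_iff.2 ha0)]
  · rw [norm_div, norm_div, norm_div, h0, h1,
      div_self (div_ne_zero (norm_ne_zero_iff.2 ha1) (norm_ne_zero_iff.2 ha0))]
  · rw [eq_mul_normalizeSeq hb0 hb1 j, h, eq_mul_normalizeSeq ha0 ha1 j]
    simp only [div_pow]
    field_simp

theorem SameModuli.normalizeSeq {M : ℕ} {ψ : ℝ} (h : SameModuli M ψ b a) (h0 : ‖b 0‖ = ‖a 0‖)
    (h1 : ‖b 1‖ = ‖a 1‖) : SameModuli M ψ (normalizeSeq b) (normalizeSeq a) := by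
  intro k hk hk' m hm
  unfold FROG.normalizeSeq
  simp [cosSum_scale, h k hk hk' m hm, h0, h1]

theorem SameModuli.norm_zero_and_norm_one {M : ℕ} {ψ : ℝ} (hψ0 : 0 < ψ) (hψ1 : ψ < Real.pi / 4)
    (hM : 2 ≤ M) (ha1 : a 1 ≠ 0) (h : SameModuli M ψ b a) : ‖b 0‖ = ‖a 0‖ ∧ ‖b 1‖ = ‖a 1‖ := by
  have h_prod : ‖b 0‖ * ‖b 1‖ = ‖a 0‖ * ‖a 1‖ := by
    have := h 1 le_rfl (by omega) 0 (by norm_num)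
    simpa [cosSum_eq_add, cosSum_of_lt] using this
  have h_one := (norm_mul_eq_and_re_eq_of_order_two hψ0 hψ1 (h 2 (by omega) (by omega))).2.2
  refine ⟨?_, h_one⟩
  rw [h_one] at h_prod
  exact mul_right_cancel₀ (norm_ne_zero_iff.2 ha1) h_prod

theorem DeterminedUpToConj.isTwist {M : ℕ} {ψ : ℝ} (hψ0 : 0 < ψ) (hψ1 : ψ < Real.pi / 4)
    (hM : 2 ≤ M) (ha : ∀ j, M < j → a j = 0) (hb : ∀ j, M < j → b j = 0) (ha0 : a 0 ≠ 0)
    (ha1 : a 1 ≠ 0) (hdet : DeterminedUpToConj M ψ (normalizeSeq a)) (h : SameModuli M ψ b a) :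
    IsTwist b a ∨ IsTwist b fun j => conj (a j) := by
  obtain ⟨h0, h1⟩ := h.norm_zero_and_norm_one hψ0 hψ1 hM ha1
  have hb0 : b 0 ≠ 0 := by rwa [← norm_ne_zero_iff, h0, norm_ne_zero_iff]
  have hb1 : b 1 ≠ 0 := by rwa [← norm_ne_zero_iff, h1, norm_ne_zero_iff]
  obtain h_eq | h_eq := hdet _ (isNormalized_normalizeSeq ha ha0 ha1)
    (isNormalized_normalizeSeq hb hb0 hb1) (h.normalizeSeq h0 h1)
  · exact .inl (isTwist_of_normalizeSeq_eq ha0 ha1 h0 h1 h_eq)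
  · refine .inr (isTwist_of_normalizeSeq_eq (by simpa using ha0) (by simpa using ha1)
      (by simpa using h0) (by simpa using h1) fun j => ?_)
    rw [h_eq, conj_normalizeSeq]

end Normalization

/-! ### The Fourier transform of a signal -/

theorem norm_sum_phaseFactor {N M : ℕ} (hN : N = 2 * M) (a : ℕ → ℂ) (k L m : ℕ) :
    ‖∑ l ∈ Finset.range (k + 1), a l * a (k - l) * phaseFactor N L ^ (l * m)‖
      = ‖cosSum a k 0 (m * (Real.pi * L / (2 * M)))‖ := by
  rw [← norm_sum_exp_eq_norm_cosSum]
  congr 1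
  refine Finset.sum_congr rfl fun l _ => ?_
  congr 1
  rw [phaseFactor, ← Complex.exp_nat_mul, ← Complex.exp_nat_mul, hN]
  congr 1
  push_cast
  ring

section Fourier

variable {N : ℕ} [NeZero N]

theorem dft_mul_eq_sum (f g : Signal N) (k : ZMod N) :
    ZMod.dft (fun n => f n * g n) k
      = (N : ℂ)⁻¹ * ∑ l, ZMod.dft f (k - l) * ZMod.dft g l := by
  have h_inversion (n : ZMod N) :
      g n = (N : ℂ)⁻¹ * ∑ l, ZMod.stdAddChar (l * n) * ZMod.dft g l := by
    conv_lhs => rw [← LinearEquiv.symm_apply_apply ZMod.dft g, ZMod.invDFT_apply]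
    simp only [smul_eq_mul]
  have h_char (n l : ZMod N) : (ZMod.stdAddChar (-(n * (k - l))) : ℂ)
      = ZMod.stdAddChar (-(n * k)) * ZMod.stdAddChar (l * n) := by
    rw [← AddChar.map_add_eq_mul]
    ring_nf
  simp_rw [ZMod.dft_apply _ (k - _), ZMod.dft_apply _ k, smul_eq_mul, Finset.sum_mul]
  rw [Finset.sum_comm, Finset.mul_sum]
  refine Finset.sum_congr rfl fun n _ => ?_
  rw [h_inversion n, Finset.mul_sum, Finset.mul_sum, Finset.mul_sum, Finset.mul_sum]
  refine Finset.sum_congr rfl fun l _ => ?_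
  rw [h_char]
  ring

theorem dft_comp_add_right (f : Signal N) (c k : ZMod N) :
    ZMod.dft (fun n => f (n + c)) k = ZMod.stdAddChar (k * c) * ZMod.dft f k := by
  rw [ZMod.dft_apply, ZMod.dft_apply, Finset.mul_sum]
  refine Fintype.sum_equiv (Equiv.addRight c) _ _ fun n => ?_
  rw [Equiv.coe_addRight, smul_eq_mul, smul_eq_mul, ← mul_assoc, ← AddChar.map_add_eq_mul]
  ring_nf

theorem dft_conj (z : Signal N) (k : ZMod N) :
    ZMod.dft (fun n => conj (z n)) k = conj (ZMod.dft z (-k)) := by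
  rw [ZMod.dft_apply, ZMod.dft_apply, map_sum]
  refine Finset.sum_congr rfl fun n _ => ?_
  rw [smul_eq_mul, smul_eq_mul, map_mul, ← AddChar.map_neg_eq_conj, mul_neg, neg_neg]

theorem dft_reflection (z : Signal N) (k : ZMod N) :
    ZMod.dft (reflection z) k = conj (ZMod.dft z k) := by
  refine (congrFun (ZMod.dft_comp_neg fun m => conj (z m)) k).trans ?_
  rw [dft_conj, neg_neg]

theorem dft_rotation_translation (θ γ : ℝ) (z : Signal N) (k : ZMod N) :
    ZMod.dft (rotation θ (translation γ z)) k = Complex.exp (θ * Complex.I)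
      * Complex.exp ((2 * Real.pi * γ / N : ℝ) * Complex.I) ^ k.val * ZMod.dft z k := by
  have h_rotation : rotation θ (translation γ z) = Complex.exp (θ * Complex.I) • translation γ z :=
    rfl
  rw [h_rotation, map_smul, Pi.smul_apply, smul_eq_mul, translation, LinearEquiv.apply_symm_apply,
    ← Complex.exp_nat_mul, mul_assoc, mul_comm (ZMod.dft z k)]
  push_cast
  ring_nf

theorem stdAddChar_natCast_mul (L l m : ℕ) :
    ZMod.stdAddChar ((l : ZMod N) * ((m * L : ℕ) : ZMod N)) = phaseFactor N L ^ (l * m) := by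
  have h_cast : (l : ZMod N) * ((m * L : ℕ) : ZMod N) = ((l * (m * L) : ℤ) : ZMod N) := by
    push_cast
    rfl
  rw [h_cast, ZMod.stdAddChar_coe, phaseFactor, ← Complex.exp_nat_mul]
  congr 1
  push_cast
  ring

theorem sum_zmod_eq_sum_range (F : ZMod N → ℂ) : ∑ l, F l = ∑ l ∈ Finset.range N, F l :=
  Finset.sum_nbij' ZMod.val (fun l => (l : ZMod N)) (by simp [ZMod.val_lt]) (by simp) (by simp)
    (fun l hl => ZMod.val_natCast_of_lt (Finset.mem_range.1 hl)) (by simp)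

theorem yHat_eq_sum (L : ℕ) (z : Signal N) (k m : ℕ) :
    yHat L z k m = (N : ℂ)⁻¹ * ∑ l ∈ Finset.range N,
      ZMod.dft z l * ZMod.dft z ((k : ZMod N) - l) * phaseFactor N L ^ (l * m) := by
  rw [yHat, dft_mul_eq_sum, sum_zmod_eq_sum_range]
  simp_rw [dft_comp_add_right, stdAddChar_natCast_mul]
  congr 1
  refine Finset.sum_congr rfl fun l _ => ?_
  ring

/-- The DFT entries of index at most `N / 2`, as a sequence. -/
def halfCoef (z : Signal N) (j : ℕ) : ℂ := if j ≤ N / 2 then ZMod.dft z j else 0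

theorem halfCoef_of_lt (z : Signal N) {j : ℕ} (h : N / 2 < j) : halfCoef z j = 0 :=
  if_neg (by omega)

theorem HasHalfSupport.dft_eq {z : Signal N} (hz : HasHalfSupport z) (k : ZMod N) :
    ZMod.dft z k = halfCoef z k.val := by
  by_cases hk : k.val ≤ N / 2
  · rw [halfCoef, if_pos hk, ZMod.natCast_zmod_val]
  · rw [halfCoef_of_lt z (by omega), hz k (by omega)]

theorem HasHalfSupport.dft_natCast_eq {z : Signal N} (hz : HasHalfSupport z) {j : ℕ} (hj : j < N) :
    ZMod.dft z j = halfCoef z j := by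
  rw [hz.dft_eq, ZMod.val_natCast_of_lt hj]

theorem HasHalfSupport.reflection {z : Signal N} (hz : HasHalfSupport z) :
    HasHalfSupport (reflection z) := fun k hk => by
  rw [dft_reflection, hz k hk, map_zero]

theorem halfCoef_reflection (z : Signal N) (j : ℕ) :
    halfCoef (reflection z) j = conj (halfCoef z j) := by
  rw [halfCoef, halfCoef, dft_reflection, apply_ite conj, map_zero]

theorem HasHalfSupport.yHat_eq_sum {z : Signal N} (hz : HasHalfSupport z) {k : ℕ} (hk : 1 ≤ k)
    (hkN : k < N) (L m : ℕ) :
    yHat L z k m = (N : ℂ)⁻¹ * ∑ l ∈ Finset.range (k + 1),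
      halfCoef z l * halfCoef z (k - l) * phaseFactor N L ^ (l * m) := by
  rw [FROG.yHat_eq_sum, ← Finset.sum_subset (Finset.range_mono (by omega : k + 1 ≤ N))]
  · congr 1
    refine Finset.sum_congr rfl fun l hl => ?_
    rw [Finset.mem_range] at hl
    rw [← Nat.cast_sub (by omega), hz.dft_natCast_eq (by omega), hz.dft_natCast_eq (by omega)]
  · intro l hl hl'
    rw [Finset.mem_range] at hl hl'
    obtain h | h := le_or_gt l (N / 2)
    · have h_wrap : (k : ZMod N) - l = ((N + k - l : ℕ) : ZMod N) := by
        rw [Nat.cast_sub (by omega)]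
        simp
      rw [h_wrap, hz.dft_natCast_eq (j := N + k - l) (by omega), halfCoef_of_lt z (by omega),
        mul_zero, zero_mul]
    · rw [hz.dft_natCast_eq hl, halfCoef_of_lt z h, zero_mul, zero_mul]

theorem HasHalfSupport.sum_dft_eq {z : Signal N} (hz : HasHalfSupport z) {k : ℕ} (hkN : k < N)
    {s : Finset ℕ} (hs : s ⊆ Finset.range (k + 1))
    (hs' : ∀ l ≤ k, l ≤ N / 2 → k - l ≤ N / 2 → l ∈ s) (L m : ℕ) :
    ∑ l ∈ s, ZMod.dft z l * ZMod.dft z (k - l : ℕ) * phaseFactor N L ^ (l * m)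
      = ∑ l ∈ Finset.range (k + 1), halfCoef z l * halfCoef z (k - l)
          * phaseFactor N L ^ (l * m) := by
  rw [← Finset.sum_subset hs]
  · refine Finset.sum_congr rfl fun l hl => ?_
    have := Finset.mem_range.1 (hs hl)
    rw [hz.dft_natCast_eq (by omega), hz.dft_natCast_eq (by omega)]
  · intro l hl hl'
    obtain h | h := le_or_gt l (N / 2)
    · have h' : N / 2 < k - l := by
        by_contra h''
        exact hl' (hs' l (Finset.mem_range_succ_iff.1 hl) h (by omega))
      rw [halfCoef_of_lt z h', mul_zero, zero_mul]
    · rw [halfCoef_of_lt z h, zero_mul, zero_mul]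

theorem sqrt_frogMeasurement_eq_iff {M L : ℕ} (hN : N = 2 * M) {z zt : Signal N}
    (hz : HasHalfSupport z) (hzt : HasHalfSupport zt) {k : ℕ} (hk : 1 ≤ k) (hkN : k < N)
    {s : Finset ℕ} (hs : s ⊆ Finset.range (k + 1))
    (hs' : ∀ l ≤ k, l ≤ N / 2 → k - l ≤ N / 2 → l ∈ s) (m : ℕ) :
    Real.sqrt (frogMeasurement L z k m) = 1 / (N : ℝ) *
        ‖∑ l ∈ s, ZMod.dft zt l * ZMod.dft zt (k - l : ℕ) * phaseFactor N L ^ (l * m)‖ ↔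
      ‖cosSum (halfCoef zt) k 0 (m * (Real.pi * L / (2 * M)))‖
        = ‖cosSum (halfCoef z) k 0 (m * (Real.pi * L / (2 * M)))‖ := by
  have hN0 : (N : ℝ)⁻¹ ≠ 0 := inv_ne_zero (NeZero.ne _)
  rw [frogMeasurement, Real.sqrt_sq (norm_nonneg _), hz.yHat_eq_sum hk hkN,
    hzt.sum_dft_eq hkN hs hs', norm_mul, norm_sum_phaseFactor hN, norm_sum_phaseFactor hN, norm_inv,
    Complex.norm_natCast, one_div, mul_right_inj' hN0, eq_comm]

theorem solvesRelaxed_iff {M L : ℕ} (hN : N = 2 * M) {z : Signal N} (hz : HasHalfSupport z)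
    (zt : Signal N) :
    SolvesRelaxed L z zt ↔ HasHalfSupport zt ∧ ∀ m < numDelays N L, ∀ k, 1 ≤ k → k < 2 * M →
      ‖cosSum (halfCoef zt) k 0 (m * (Real.pi * L / (2 * M)))‖
        = ‖cosSum (halfCoef z) k 0 (m * (Real.pi * L / (2 * M)))‖ := by
  refine and_congr_right fun hzt => forall₂_congr fun m _ => ?_
  have h_low (k : ℕ) (hk : k ∈ Finset.Icc 1 (N / 2)) := by
    rw [Finset.mem_Icc] at hk
    exact sqrt_frogMeasurement_eq_iff (L := L) hN hz hzt hk.1 (by omega) subset_rfl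
      (fun l hl _ _ => Finset.mem_range_succ_iff.2 hl) m
  have h_high (k : ℕ) (hk : k ∈ Finset.Icc (N / 2 + 1) (N - 1)) := by
    rw [Finset.mem_Icc] at hk
    exact sqrt_frogMeasurement_eq_iff (L := L) (k := k)
      (s := Finset.Icc (k - N / 2) (N / 2)) hN hz hzt (by omega) (by omega)
      (fun l hl => by grind) (fun l _ _ _ => by grind) m
  rw [forall₂_congr h_low, forall₂_congr h_high]
  simp only [Finset.mem_Icc]
  refine ⟨fun h k hk hkM => ?_, fun h => ⟨fun k hk => h k (by omega) (by omega),
    fun k hk => h k (by omega) (by omega)⟩⟩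
  obtain h' | h' := le_or_gt k (N / 2)
  · exact h.1 k ⟨hk, h'⟩
  · exact h.2 k ⟨by omega, by omega⟩

theorem exists_eq_rotation_translation_iff {u v : Signal N} :
    (∃ θ γ, u = rotation θ (translation γ v)) ↔ ∃ x y : ℂ, ‖x‖ = 1 ∧ ‖y‖ = 1 ∧
      ∀ k : ZMod N, ZMod.dft u k = x * y ^ k.val * ZMod.dft v k := by
  constructor
  · rintro ⟨θ, γ, rfl⟩
    exact ⟨_, _, Complex.norm_exp_ofReal_mul_I _, Complex.norm_exp_ofReal_mul_I _,
      dft_rotation_translation θ γ v⟩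
  · rintro ⟨x, y, hx, hy, h⟩
    obtain ⟨θ, rfl⟩ := (Complex.norm_eq_one_iff x).1 hx
    obtain ⟨η, rfl⟩ := (Complex.norm_eq_one_iff y).1 hy
    refine ⟨θ, η * N / (2 * Real.pi), ZMod.dft.injective (funext fun k => ?_)⟩
    have hN0 : (N : ℝ) ≠ 0 := NeZero.ne _
    have hη : 2 * Real.pi * (η * N / (2 * Real.pi)) / N = η := by field_simp
    rw [h, dft_rotation_translation, hη]

theorem HasHalfSupport.exists_eq_rotation_translation_iff {u v : Signal N}
    (hv : HasHalfSupport v) :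
    (∃ θ γ, u = rotation θ (translation γ v)) ↔
      HasHalfSupport u ∧ IsTwist (halfCoef u) (halfCoef v) := by
  rw [FROG.exists_eq_rotation_translation_iff]
  constructor
  · rintro ⟨x, y, hx, hy, h⟩
    refine ⟨fun k hk => by rw [h, hv k hk, mul_zero], x, y, hx, hy, fun j => ?_⟩
    obtain hj | hj := le_or_gt j (N / 2)
    · have hval : (j : ZMod N).val = j :=
        ZMod.val_natCast_of_lt (hj.trans_lt (Nat.div_lt_self (NeZero.pos N) one_lt_two))
      rw [halfCoef, halfCoef, if_pos hj, if_pos hj, h, hval]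
    · rw [halfCoef_of_lt _ hj, halfCoef_of_lt _ hj, mul_zero]
  · rintro ⟨hu, x, y, hx, hy, h⟩
    exact ⟨x, y, hx, hy, fun k => by rw [hu.dft_eq, hv.dft_eq, h]⟩

theorem HasHalfSupport.sameUpToAmbiguity_iff {u v : Signal N} (hv : HasHalfSupport v) :
    SameUpToAmbiguity u v ↔ HasHalfSupport u ∧
      (IsTwist (halfCoef u) (halfCoef v) ∨ IsTwist (halfCoef u) fun j => conj (halfCoef v j)) := by
  simp_rw [SameUpToAmbiguity, exists_or, hv.exists_eq_rotation_translation_iff,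
    hv.reflection.exists_eq_rotation_translation_iff, ← and_or_left,
    funext (halfCoef_reflection v)]

end Fourier

/-! ### Genericity for analytic signals -/

section Analytic

variable {N : ℕ} [NeZero N]

theorem dft_analyticSignal (x : ZMod N → ℝ) (k : ZMod N) :
    ZMod.dft (analyticSignal N x) k =
      if k.val = 0 ∨ 2 * k.val = N then ZMod.dft (fun n => (x n : ℂ)) k
      else if 2 * k.val < N then 2 * ZMod.dft (fun n => (x n : ℂ)) k else 0 := by
  rw [analyticSignal, LinearEquiv.apply_symm_apply]

theorem IsAnalytic.hasHalfSupport {z : Signal N} (hz : IsAnalytic z) : HasHalfSupport z := by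
  obtain ⟨x, rfl⟩ := hz
  intro k hk
  rw [dft_analyticSignal, if_neg (by omega), if_neg (by omega)]

theorem IsAnalytic.dft_zero_im {z : Signal N} (hz : IsAnalytic z) : (ZMod.dft z 0).im = 0 := by
  obtain ⟨x, rfl⟩ := hz
  rw [dft_analyticSignal, if_pos (by simp), ZMod.dft_apply_zero]
  simp

theorem dft_ofReal_re (y : Signal N) (k : ZMod N) :
    ZMod.dft (fun n => ((y n).re : ℂ)) k
      = 2⁻¹ * (ZMod.dft y k + conj (ZMod.dft y (-k))) := by
  have h_re : (fun n => ((y n).re : ℂ)) = (2⁻¹ : ℂ) • (y + fun n => conj (y n)) := by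
    funext n
    simp [Complex.re_eq_add_conj, div_eq_inv_mul]
  rw [h_re, map_smul, map_add, Pi.smul_apply, Pi.add_apply, smul_eq_mul, dft_conj]

theorem exists_isAnalytic {M : ℕ} (hN : N = 2 * M) (α : ℕ → ℂ) (h0 : (α 0).im = 0) :
    ∃ z : Signal N, IsAnalytic z ∧ ∀ j < M, ZMod.dft z j = α j := by
  obtain ⟨y, hy⟩ : ∃ y : Signal N, ∀ k, ZMod.dft y k = if k.val < M then α k.val else 0 :=
    ⟨ZMod.dft.symm fun k => if k.val < M then α k.val else 0, fun k => by
      rw [LinearEquiv.apply_symm_apply]⟩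
  refine ⟨analyticSignal N fun n => (y n).re, ⟨_, rfl⟩, fun j hj => ?_⟩
  have hval : (j : ZMod N).val = j := ZMod.val_natCast_of_lt (by omega)
  rw [dft_analyticSignal, hval, dft_ofReal_re, hy, hval, if_pos hj]
  obtain rfl | hj0 := j.eq_zero_or_pos
  · rw [if_pos (.inl rfl), Nat.cast_zero, neg_zero, hy, ZMod.val_zero, if_pos hj,
      Complex.conj_eq_iff_im.2 h0]
    ring
  · have h_neg : ZMod.dft y (-(j : ZMod N)) = 0 := by
      have h_cast : -(j : ZMod N) = ((N - j : ℕ) : ZMod N) := by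
        rw [Nat.cast_sub (by omega)]
        simp
      rw [h_cast, hy, ZMod.val_natCast_of_lt (by omega), if_neg (by omega)]
    rw [if_neg (by omega), if_pos (by omega), h_neg]
    simp

variable (N) in
/-- The polynomial functions in the DFT entries of a signal and their conjugates. -/
def signalPoly : StarSubalgebra ℂ (Signal N → ℂ) :=
  StarAlgebra.adjoin ℂ (Set.range fun k z => ZMod.dft z k)

theorem dft_mem_signalPoly (k : ZMod N) : (fun z => ZMod.dft z k) ∈ signalPoly N :=
  StarAlgebra.subset_adjoin ℂ _ ⟨k, rfl⟩

theorem halfCoef_mem_signalPoly (j : ℕ) : (fun z => halfCoef z j) ∈ signalPoly N := by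
  by_cases hj : j ≤ N / 2
  · simpa only [halfCoef, if_pos hj] using dft_mem_signalPoly (j : ZMod N)
  · simpa only [halfCoef, if_neg hj] using const_mem (signalPoly N) 0

theorem exists_mvPolynomial_re_im {g : Signal N → ℂ} (hg : g ∈ signalPoly N) :
    ∃ P Q : MvPolynomial (ZMod N ⊕ ZMod N) ℝ,
      ∀ z, g z = ⟨MvPolynomial.eval (coords z) P, MvPolynomial.eval (coords z) Q⟩ := by
  rw [signalPoly] at hg
  induction hg using StarAlgebra.adjoin_induction with
  | mem g hg =>
    obtain ⟨k, rfl⟩ := hg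
    exact ⟨.X (.inl k), .X (.inr k), fun z => by simp [coords]⟩
  | algebraMap c => exact ⟨.C c.re, .C c.im, fun z => by simp⟩
  | add f g _ _ hf hg =>
    obtain ⟨P, Q, hf⟩ := hf
    obtain ⟨P', Q', hg⟩ := hg
    exact ⟨P + P', Q + Q', fun z => by simp [hf, hg, Complex.ext_iff]⟩
  | mul f g _ _ hf hg =>
    obtain ⟨P, Q, hf⟩ := hf
    obtain ⟨P', Q', hg⟩ := hg
    exact ⟨P * P' - Q * Q', P * Q' + Q * P', fun z => by simp [hf, hg, Complex.ext_iff]⟩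
  | star f _ hf =>
    obtain ⟨P, Q, hf⟩ := hf
    exact ⟨P, -Q, fun z => by simp [hf, Complex.ext_iff]⟩

theorem exists_mvPolynomial_normSq {g : Signal N → ℂ} (hg : g ∈ signalPoly N) :
    ∃ P : MvPolynomial (ZMod N ⊕ ZMod N) ℝ,
      ∀ z, MvPolynomial.eval (coords z) P = Complex.normSq (g z) := by
  obtain ⟨P, Q, h⟩ := exists_mvPolynomial_re_im hg
  exact ⟨P * P + Q * Q, fun z => by simp [h, Complex.normSq_apply]⟩

end Analytic

section ClearDenominators

variable {N : ℕ} [NeZero N]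

/-- `|ẑ₀ ẑ₁|²`, a power of which clears the denominators of a polynomial in the entries of
`normalizeSeq (halfCoef z)`. -/
def normalizer (z : Signal N) : ℂ := Complex.normSq (halfCoef z 0 * halfCoef z 1)

theorem normalizer_mem_signalPoly : normalizer ∈ signalPoly N :=
  ofReal_normSq_mem (mul_mem (halfCoef_mem_signalPoly 0) (halfCoef_mem_signalPoly 1))

theorem exists_eq_normalizer_pow_mul_entry (j : ℕ) :
    ∃ n, ∃ g ∈ signalPoly N, ∀ z, halfCoef z 0 ≠ 0 → halfCoef z 1 ≠ 0 →
      g z = normalizer z ^ n * normalizeSeq (halfCoef z) j := by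
  let c (i : ℕ) (z : Signal N) : ℂ := halfCoef z i
  have hc (i : ℕ) : c i ∈ signalPoly N := halfCoef_mem_signalPoly i
  refine ⟨j + 1, star (c 0) * (c 1 * star (c 1)) * (c 0 ^ 2 * star (c 0) * star (c 1)) ^ j * c j,
    mul_mem (mul_mem (mul_mem (star_mem (hc 0)) (mul_mem (hc 1) (star_mem (hc 1))))
      (pow_mem (mul_mem (mul_mem (pow_mem (hc 0) 2) (star_mem (hc 0))) (star_mem (hc 1))) j))
      (hc j), fun z h0 h1 => ?_⟩
  simp only [c, normalizer, normalizeSeq, map_mul, Complex.ofReal_mul, ← Complex.mul_conj,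
    Pi.mul_apply, Pi.pow_apply, Pi.star_apply, Complex.star_def, div_pow]
  field_simp
  ring

theorem exists_eq_normalizer_pow_mul {M : ℕ} {f : (ℕ → ℂ) → ℂ} (hf : f ∈ seqPoly M) :
    ∃ n, ∃ g ∈ signalPoly N, ∀ z, halfCoef z 0 ≠ 0 → halfCoef z 1 ≠ 0 →
      g z = normalizer z ^ n * f (normalizeSeq (halfCoef z)) := by
  have hpow (n : ℕ) : normalizer ^ n ∈ signalPoly N := pow_mem normalizer_mem_signalPoly n
  rw [seqPoly] at hf
  induction hf using StarAlgebra.adjoin_induction with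
  | mem f hf =>
    obtain ⟨j, -, rfl⟩ := hf
    exact exists_eq_normalizer_pow_mul_entry j
  | algebraMap c => exact ⟨0, _, const_mem _ c, fun z _ _ => by simp⟩
  | add f₁ f₂ _ _ ih₁ ih₂ =>
    obtain ⟨n₁, g₁, hg₁, h₁⟩ := ih₁
    obtain ⟨n₂, g₂, hg₂, h₂⟩ := ih₂
    refine ⟨n₁ + n₂, normalizer ^ n₂ * g₁ + normalizer ^ n₁ * g₂,
      add_mem (mul_mem (hpow n₂) hg₁) (mul_mem (hpow n₁) hg₂), fun z h0 h1 => ?_⟩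
    simp only [Pi.add_apply, Pi.mul_apply, Pi.pow_apply, h₁ z h0 h1, h₂ z h0 h1]
    ring
  | mul f₁ f₂ _ _ ih₁ ih₂ =>
    obtain ⟨n₁, g₁, hg₁, h₁⟩ := ih₁
    obtain ⟨n₂, g₂, hg₂, h₂⟩ := ih₂
    refine ⟨n₁ + n₂, g₁ * g₂, mul_mem hg₁ hg₂, fun z h0 h1 => ?_⟩
    simp only [Pi.mul_apply, h₁ z h0 h1, h₂ z h0 h1]
    ring
  | star f _ ih =>
    obtain ⟨n, g, hg, h⟩ := ih
    refine ⟨n, star g, star_mem hg, fun z h0 h1 => ?_⟩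
    simp [h z h0 h1, normalizer]

end ClearDenominators

section Genericity

variable {N : ℕ} [NeZero N]

theorem halfCoef_zero (z : Signal N) : halfCoef z 0 = ZMod.dft z 0 := by
  simp [halfCoef]

theorem halfCoef_one (hN : 2 ≤ N) (z : Signal N) : halfCoef z 1 = ZMod.dft z 1 := by
  rw [halfCoef, if_pos (by omega), Nat.cast_one]

theorem ForGenericAnalytic.mono {P Q : Signal N → Prop} (hP : ForGenericAnalytic N P)
    (h : ∀ z, IsAnalytic z → P z → Q z) : ForGenericAnalytic N Q := by
  obtain ⟨p, hp, hpP⟩ := hP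
  exact ⟨p, hp, fun z hz hpz => h z hz (hpP z hz hpz)⟩

theorem GenericSeq.forGenericAnalytic {M : ℕ} (hN : N = 2 * M) (hM : 2 ≤ M)
    {S : (ℕ → ℂ) → Prop} (hS : GenericSeq M S) :
    ForGenericAnalytic N fun z =>
      ZMod.dft z 0 ≠ 0 → ZMod.dft z 1 ≠ 0 → S (normalizeSeq (halfCoef z)) := by
  obtain ⟨f, hf, ⟨α, hα0, hα1, hα⟩, hfS⟩ := hS
  obtain ⟨n, g, hg, hgf⟩ := exists_eq_normalizer_pow_mul (N := N) hf
  obtain ⟨P, hP⟩ := exists_mvPolynomial_normSq hg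
  refine ⟨P, ?_, fun z _ hPz h0 h1 => ?_⟩
  · obtain ⟨z, hz, hzα⟩ := exists_isAnalytic hN α (by simp [hα0])
    have h_coef (j : ℕ) (hj : j < M) : halfCoef z j = α j := by
      rw [halfCoef, if_pos (by omega), hzα j hj]
    have h0 : halfCoef z 0 = 1 := (h_coef 0 (by omega)).trans hα0
    have h1 : halfCoef z 1 = 1 := (h_coef 1 (by omega)).trans hα1
    have h_agree : f (normalizeSeq (halfCoef z)) = f α :=
      eq_of_mem_seqPoly hf fun j hj => by simp [normalizeSeq, h0, h1, h_coef j hj]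
    refine ⟨z, hz, ?_⟩
    rw [hP, Ne, Complex.normSq_eq_zero, hgf z (by simp [h0]) (by simp [h1]), h_agree]
    simpa [normalizer, h0, h1] using hα
  · rw [← halfCoef_zero] at h0
    rw [← halfCoef_one (by omega)] at h1
    have h_norm := isNormalized_normalizeSeq (fun j hj => halfCoef_of_lt z hj) h0 h1
    refine hfS _ h_norm.zero h_norm.one fun h => hPz ?_
    rw [hP, hgf z h0 h1, h, mul_zero, map_zero]

end Genericity

/-! ### The solutions of the relaxed system -/

section Twist

variable {a b c : ℕ → ℂ}

theorem IsTwist.symm (h : IsTwist b a) : IsTwist a b := by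
  obtain ⟨x, y, hx, hy, h⟩ := h
  have hx0 : x ≠ 0 := by simp [← norm_ne_zero_iff, hx]
  have hy0 : y ≠ 0 := by simp [← norm_ne_zero_iff, hy]
  refine ⟨x⁻¹, y⁻¹, by simp [hx], by simp [hy], fun j => ?_⟩
  rw [h, inv_pow]
  field_simp

theorem IsTwist.trans (h : IsTwist c b) (h' : IsTwist b a) : IsTwist c a := by
  obtain ⟨x, y, hx, hy, h⟩ := h
  obtain ⟨x', y', hx', hy', h'⟩ := h'
  refine ⟨x * x', y * y', by simp [hx, hx'], by simp [hy, hy'], fun j => ?_⟩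
  rw [h, h', mul_pow]
  ring

theorem IsTwist.conj (h : IsTwist b a) :
    IsTwist (fun j => conj (b j)) fun j => conj (a j) := by
  obtain ⟨x, y, hx, hy, h⟩ := h
  exact ⟨conj x, conj y, by simp [hx], by simp [hy], fun j => by simp [h]⟩

theorem IsTwist.norm_eq (h : IsTwist b a) (j : ℕ) : ‖b j‖ = ‖a j‖ := by
  obtain ⟨x, y, hx, hy, h⟩ := h
  simp [h, hx, hy]

theorem IsTwist.norm_cosSum_eq (h : IsTwist b a) (k i : ℕ) (t : ℝ) :
    ‖cosSum b k i t‖ = ‖cosSum a k i t‖ := by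
  obtain ⟨x, y, hx, hy, h⟩ := h
  rw [funext h, cosSum_scale]
  simp [hx, hy]

theorem IsTwist.eq_of_arg_eq_zero (h : IsTwist b a) (ha0 : a 0 ≠ 0) (ha1 : a 1 ≠ 0)
    (hb0 : (b 0).arg = 0) (hb1 : (b 1).arg = 0) (ha0' : (a 0).arg = 0) (ha1' : (a 1).arg = 0) :
    b = a := by
  have h0 : b 0 = a 0 := Complex.ext_norm_arg (h.norm_eq 0) (hb0.trans ha0'.symm)
  have h1 : b 1 = a 1 := Complex.ext_norm_arg (h.norm_eq 1) (hb1.trans ha1'.symm)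
  obtain ⟨x, y, -, -, h⟩ := h
  obtain rfl : x = 1 := by simpa [h0, ha0] using h 0
  obtain rfl : y = 1 := by simpa [h1, ha1] using h 1
  simpa using funext h

end Twist

section Solutions

variable {N : ℕ} [NeZero N] {z v zt : Signal N}

theorem two_mul_lt_of_five_le_numDelays {M L : ℕ} (hL : 0 < L) (hr : 5 ≤ numDelays (2 * M) L) :
    2 * L < M := by
  have h_lt : (4 : ℕ) < ⌈((2 * M : ℕ) : ℝ) / (L : ℝ)⌉₊ := hr
  rw [Nat.lt_ceil, lt_div_iff₀ (by exact_mod_cast hL)] at h_lt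
  have : 4 * L < 2 * M := by exact_mod_cast h_lt
  omega

theorem solvesRelaxed_iff_sameUpToAmbiguity {M L : ℕ} (hN : N = 2 * M) (hL : 0 < L)
    (hLM : 2 * L < M) (hr : 5 ≤ numDelays N L) (hz : HasHalfSupport z) (h0 : ZMod.dft z 0 ≠ 0)
    (h1 : ZMod.dft z 1 ≠ 0)
    (hdet : DeterminedUpToConj M (Real.pi * L / (2 * M)) (normalizeSeq (halfCoef z))) :
    SolvesRelaxed L z zt ↔ SameUpToAmbiguity zt z := by
  rw [solvesRelaxed_iff hN hz, hz.sameUpToAmbiguity_iff]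
  refine and_congr_right fun _ => ⟨fun h => ?_, ?_⟩
  · rw [← halfCoef_zero] at h0
    rw [← halfCoef_one (by omega)] at h1
    exact hdet.isTwist (delayAngle_pos hL hLM) (delayAngle_lt hL hLM) (by omega)
      (fun j hj => halfCoef_of_lt z (by omega)) (fun j hj => halfCoef_of_lt zt (by omega)) h0 h1
      fun k hk hk' m hm => h m (by omega) k hk hk'
  · rintro (h | h) m - k - -
    · exact h.norm_cosSum_eq k 0 _
    · rw [h.norm_cosSum_eq, cosSum_conj, Complex.norm_conj]

theorem HasHalfSupport.ext (hz : HasHalfSupport z) (hv : HasHalfSupport v)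
    (h : halfCoef z = halfCoef v) : z = v :=
  ZMod.dft.injective (funext fun k => by rw [hz.dft_eq, hv.dft_eq, h])

theorem sameUpToAmbiguity_congr_right (hz : HasHalfSupport z) (hv : HasHalfSupport v)
    (h : IsTwist (halfCoef v) (halfCoef z)) :
    SameUpToAmbiguity zt z ↔ SameUpToAmbiguity zt v := by
  rw [hz.sameUpToAmbiguity_iff, hv.sameUpToAmbiguity_iff]
  exact and_congr_right fun _ => or_congr ⟨fun h' => h'.trans h.symm, fun h' => h'.trans h⟩
    ⟨fun h' => h'.trans h.conj.symm, fun h' => h'.trans h.conj⟩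

theorem arg_conj_eq_zero {x : ℂ} (hx : x.arg = 0) : (conj x).arg = 0 := by
  rw [Complex.arg_conj, hx, if_neg Real.pi_ne_zero.symm, neg_zero]

theorem sameUpToAmbiguity_and_arg_eq_zero_iff (hN : 2 ≤ N) (hv : HasHalfSupport v)
    (h0 : ZMod.dft v 0 ≠ 0) (h1 : ZMod.dft v 1 ≠ 0) (h0' : (ZMod.dft v 0).arg = 0)
    (h1' : (ZMod.dft v 1).arg = 0) :
    (SameUpToAmbiguity zt v ∧ (ZMod.dft zt 0).arg = 0 ∧ (ZMod.dft zt 1).arg = 0) ↔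
      zt = v ∨ zt = reflection v := by
  constructor
  · simp_rw [hv.sameUpToAmbiguity_iff, ← halfCoef_reflection, ← halfCoef_zero,
      ← halfCoef_one hN] at *
    rintro ⟨⟨hzt, h | h⟩, hzt0, hzt1⟩
    · exact .inl (hzt.ext hv (h.eq_of_arg_eq_zero h0 h1 hzt0 hzt1 h0' h1'))
    · refine .inr (hzt.ext hv.reflection (h.eq_of_arg_eq_zero ?_ ?_ hzt0 hzt1 ?_ ?_)) <;>
        rw [halfCoef_reflection]
      exacts [star_ne_zero.2 h0, star_ne_zero.2 h1, arg_conj_eq_zero h0', arg_conj_eq_zero h1']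
  · rintro (rfl | rfl)
    · exact ⟨hv.sameUpToAmbiguity_iff.2 ⟨hv, .inl ⟨1, 1, by simp⟩⟩, h0', h1'⟩
    · rw [dft_reflection, dft_reflection]
      exact ⟨hv.sameUpToAmbiguity_iff.2 ⟨hv.reflection, .inr ⟨1, 1, by simp [halfCoef_reflection]⟩⟩,
        arg_conj_eq_zero h0', arg_conj_eq_zero h1'⟩

end Solutions

section NormalizedSolution

theorem sign_sq {s : ℝ} (hs : s ≠ 0) : Real.sign s ^ 2 = 1 := by
  obtain h | h := Real.sign_apply_eq_of_ne_zero s hs <;> rw [h] <;> norm_num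

theorem signFactor_eq_mul_pow {s : ℝ} (hs : s ≠ 0) (k : ℕ) :
    signFactor s k = Real.sign s * Real.sign s ^ k := by
  rw [signFactor, ← pow_succ']
  split_ifs with hk
  · obtain ⟨i, rfl⟩ := hk
    rw [← two_mul, pow_succ, pow_mul, sign_sq hs, one_pow, one_mul]
  · obtain ⟨i, hi⟩ := (Nat.not_even_iff_odd.1 hk).add_one
    rw [hi, ← two_mul, pow_mul, sign_sq hs, one_pow]

theorem norm_eq_sign_mul {x : ℂ} (hx : x.im = 0) : (‖x‖ : ℂ) = (Real.sign x.re : ℂ) * x := by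
  lift x to ℝ using hx
  rw [Complex.norm_real, Complex.ofReal_re, ← Complex.ofReal_mul, Real.norm_eq_abs,
    ← abs_of_nonneg (Real.sign_mul_nonneg x), abs_mul]
  obtain rfl | hx := eq_or_ne x 0
  · simp
  · obtain h | h := Real.sign_apply_eq_of_ne_zero x hx <;> simp [h]

variable {N : ℕ} [NeZero N] {z : Signal N} {θ : ℕ → ℝ}

theorem dft_normalizedSolution_zero (z : Signal N) (θ : ℕ → ℝ) :
    ZMod.dft (normalizedSolution z θ) 0 = ‖ZMod.dft z 0‖ := by
  rw [normalizedSolution, LinearEquiv.apply_symm_apply, if_pos ZMod.val_zero]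

theorem dft_normalizedSolution_one (hN : 2 ≤ N) (z : Signal N) (θ : ℕ → ℝ) :
    ZMod.dft (normalizedSolution z θ) 1 = ‖ZMod.dft z 1‖ := by
  have hval : (1 : ZMod N).val = 1 := ZMod.val_one'' (by omega)
  rw [normalizedSolution, LinearEquiv.apply_symm_apply, if_neg (by omega), if_pos hval]

theorem hasHalfSupport_normalizedSolution (hN : 2 ≤ N) (z : Signal N) (θ : ℕ → ℝ) :
    HasHalfSupport (normalizedSolution z θ) := fun k hk => by
  rw [normalizedSolution, LinearEquiv.apply_symm_apply, if_neg (by omega), if_neg (by omega),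
    if_neg (by omega)]

theorem dft_normalizedSolution_natCast (hN : 2 ≤ N) (him : (ZMod.dft z 0).im = 0)
    (hθ : ∀ k ≤ N / 2, ZMod.dft z k = ‖ZMod.dft z k‖ * Complex.exp (θ k * Complex.I)) {j : ℕ}
    (hj : j ≤ N / 2) :
    ZMod.dft (normalizedSolution z θ) j = signFactor (ZMod.dft z 0).re j * ‖ZMod.dft z j‖
      * Complex.exp ((θ j - j * θ 1 : ℝ) * Complex.I) := by
  have hval : (j : ZMod N).val = j := ZMod.val_natCast_of_lt (by omega)
  obtain rfl | rfl | hj2 : j = 0 ∨ j = 1 ∨ 2 ≤ j := by omega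
  · have h0 := hθ 0 hj
    simp only [Nat.cast_zero, zero_mul, sub_zero] at h0 ⊢
    rw [dft_normalizedSolution_zero, signFactor, if_pos Even.zero, mul_assoc, ← h0,
      norm_eq_sign_mul him]
  · rw [Nat.cast_one, dft_normalizedSolution_one hN]
    simp [signFactor]
  · rw [normalizedSolution, LinearEquiv.apply_symm_apply, hval, if_neg (by omega),
      if_neg (by omega), if_pos hj]

theorem isTwist_halfCoef_normalizedSolution (hN : 2 ≤ N) (him : (ZMod.dft z 0).im = 0)
    (h0 : ZMod.dft z 0 ≠ 0)
    (hθ : ∀ k ≤ N / 2, ZMod.dft z k = ‖ZMod.dft z k‖ * Complex.exp (θ k * Complex.I)) :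
    IsTwist (halfCoef (normalizedSolution z θ)) (halfCoef z) := by
  have hre : (ZMod.dft z 0).re ≠ 0 := fun h => h0 (Complex.ext h him)
  have h_norm : ‖(Real.sign (ZMod.dft z 0).re : ℂ)‖ = 1 := by
    obtain h | h := Real.sign_apply_eq_of_ne_zero _ hre <;> simp [h]
  refine ⟨Real.sign (ZMod.dft z 0).re,
    Real.sign (ZMod.dft z 0).re * Complex.exp ((-θ 1 : ℝ) * Complex.I), h_norm, ?_, fun j => ?_⟩
  · rw [norm_mul, h_norm, Complex.norm_exp_ofReal_mul_I, one_mul]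
  · by_cases hj : j ≤ N / 2
    · have h_exp : Complex.exp ((θ j - j * θ 1 : ℝ) * Complex.I)
          = Complex.exp ((-θ 1 : ℝ) * Complex.I) ^ j * Complex.exp (θ j * Complex.I) := by
        rw [← Complex.exp_nat_mul, ← Complex.exp_add]
        congr 1
        push_cast
        ring
      rw [halfCoef, halfCoef, if_pos hj, if_pos hj,
        dft_normalizedSolution_natCast hN him hθ hj, signFactor_eq_mul_pow hre, h_exp]
      conv_rhs => rw [hθ j hj]
      push_cast
      ring
    · rw [halfCoef_of_lt _ (by omega), halfCoef_of_lt _ (by omega), mul_zero]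

theorem sameUpToAmbiguity_and_arg_eq_zero_iff_normalizedSolution (hN : 2 ≤ N)
    (hz : HasHalfSupport z) (him : (ZMod.dft z 0).im = 0) (h0 : ZMod.dft z 0 ≠ 0)
    (h1 : ZMod.dft z 1 ≠ 0)
    (hθ : ∀ k ≤ N / 2, ZMod.dft z k = ‖ZMod.dft z k‖ * Complex.exp (θ k * Complex.I))
    (zt : Signal N) :
    (SameUpToAmbiguity zt z ∧ (ZMod.dft zt 0).arg = 0 ∧ (ZMod.dft zt 1).arg = 0) ↔
      zt = normalizedSolution z θ ∨ zt = reflection (normalizedSolution z θ) := by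
  have hv := hasHalfSupport_normalizedSolution hN z θ
  rw [sameUpToAmbiguity_congr_right hz hv (isTwist_halfCoef_normalizedSolution hN him h0 hθ)]
  have harg (x : ℂ) : (‖x‖ : ℂ).arg = 0 := Complex.arg_ofReal_of_nonneg (norm_nonneg x)
  refine sameUpToAmbiguity_and_arg_eq_zero_iff hN hv ?_ ?_ ?_ ?_ <;>
    simp only [dft_normalizedSolution_zero, dft_normalizedSolution_one hN, harg, ne_eq,
      Complex.ofReal_eq_zero, norm_eq_zero, h0, h1, not_false_iff]

end NormalizedSolution

end FROG

end

theorem theorem3p7 (N L : ℕ) [NeZero N] (hN : Even N) (hL : 0 < L) (hLN : L ≤ N)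
    (hr : 5 ≤ FROG.numDelays N L) :
    FROG.ForGenericAnalytic N fun z =>
      ZMod.dft z 0 ≠ 0 → ZMod.dft z 1 ≠ 0 →
        (∀ zt : FROG.Signal N, FROG.SolvesRelaxed L z zt ↔ FROG.SameUpToAmbiguity zt z) ∧
        ∀ θ : ℕ → ℝ,
          (∀ k ≤ N / 2, ZMod.dft z (k : ZMod N)
            = (‖ZMod.dft z (k : ZMod N)‖ : ℂ) * Complex.exp ((θ k : ℂ) * Complex.I)) →
          ∀ zt : FROG.Signal N,
            (FROG.SolvesRelaxed L z zt ∧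
              (ZMod.dft zt 0).arg = 0 ∧ (ZMod.dft zt 1).arg = 0) ↔
            (zt = FROG.normalizedSolution z θ ∨
              zt = FROG.reflection (FROG.normalizedSolution z θ)) := by
  obtain ⟨M, hM⟩ := hN
  rw [← two_mul] at hM
  have hLM : 2 * L < M := FROG.two_mul_lt_of_five_le_numDelays hL (hM ▸ hr)
  refine ((FROG.genericSeq_determinedUpToConj hL hLM).forGenericAnalytic hM (by omega)).mono ?_
  intro z hz hdet h0 h1
  have h_solutions (zt : FROG.Signal N) : FROG.SolvesRelaxed L z zt ↔ FROG.SameUpToAmbiguity zt z :=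
    FROG.solvesRelaxed_iff_sameUpToAmbiguity hM hL hLM hr hz.hasHalfSupport h0 h1 (hdet h0 h1)
  refine ⟨h_solutions, fun θ hθ zt => ?_⟩
  rw [h_solutions]
  exact FROG.sameUpToAmbiguity_and_arg_eq_zero_iff_normalizedSolution (by omega) hz.hasHalfSupport
    hz.dft_zero_im h0 h1 hθ zt
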